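/- **Framed graph diagrams.** A *diagram of a framed knotted 4-regular graph* is a planar diagram, up to planar isotopy, of a finite graph all of whose vertices have valence 4 (loops and multiple edges are allowed; closed edges without vertices are allowed too), with crossings of edges as usual, in which every vertex is marked by which of its two pairs of opposite incident edges lies above the projection plane (the *upper* pair) and which below (the *lower* pair), and every edge carries an integer *twist* $t$ (in units of $\pi/3$, right-handed twists being positive). We consider only diagrams that have a 3-line graph, i.e. such that the twist of an edge is even if its two ends are both upper or both lower at the vertices they enter, and odd otherwise. **3-line graph.** The 3-line graph of a diagram $D$ is the unoriented link diagram obtained as follows. Every edge is replaced by a leg of three parallel lines (two outer ones and a middle one), so that a crossing of edges becomes nine crossings of the same kind. At a vertex, the adjacent outer lines of any two neighbouring legs are joined, and the middle lines of opposite legs are joined, the middle line of the upper pair passing over that of the lower pair. An edge of twist $t$ gets a 3-braid with $|t|$ crossings, placed alternately at the left and at the right pair of neighbouring positions (as seen by a traveller along the edge); coming from a lower end, the braid word is $\sigma_2^{-1}\sigma_1^{-1}\sigma_2^{-1}\cdots$ if $t>0$ and $\sigma_1\sigma_2\sigma_1\cdots$ if $t<0$; coming from an upper end, it is $\sigma_1^{-1}\sigma_2^{-1}\sigma_1^{-1}\cdots$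 if $t>0$ and $\sigma_2\sigma_1\sigma_2\cdots$ if $t<0$. Here $\sigma_2$ is the crossing at the traveller's left pair, $\sigma_1$ the one at the right pair, and in $\sigma_i^{-1}$ the strand going from left to right is the over-strand. (Both ends of an edge give the same braid. A closed edge without vertices is given one of the two types, upper or lower, at a starting point; its twist is even.) $L(D)$ is the link obtained from the link of the 3-line graph of $D$ by removing all unlinked unknotted components, i.e. the link $K$ without split unknot component such that the 3-line graph of $D$ represents the split union of $K$ and some number of unknots. Links are link diagrams up to planar isotopy and the usual three Reidemeister moves. **Generalized Reidemeister moves** (local moves, used in both directions). - RI: two successive curls in an edge with crossings of opposite sign are removed. - RII, RIII: the usual moves for edges. RIV: an edge is moved over, or under, a vertex. - RV: let a vertex have the edges $D,C,B,A$ at west, south, east, north, with $D,B$ upper. It is replaced by a vertex with $D,C,A,B$ at west, south, east, north and with $C,B$ upper, followed by one crossing of $A$ and $B$, $B$ passing over $A$, so that $A$ again ends at north and $B$ at east; the twists of $D,C$ change by $-1$ and those of $A,B$ by $+2$. Also allowed are the rotations of this move in the plane and its mirror image (upper and lower, over and under exchanged, all twist changes negated). **Pachner moves with twists** (local moves, up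 to rotation in the plane). - 1-4 move: let a vertex have the edges $A,B,C,D$ at west, north, east, south, with $A,C$ lower. It is replaced by four vertices $a,b,c,d$ at west, north, east, south, on the ends $A,B,C,D$ respectively, any two of them joined by an edge. The edges $ab,bc,cd,da$ form a square without crossings and have twists $+1,-1,+1,-1$; the diagonals $ac,bd$ have twist $0$ and cross once, $bd$ passing over $ac$. The external edge and the diagonal are opposite at each vertex; they are lower at $a,c$ and upper at $b,d$. The twists of $A,B,C,D$ do not change. The mirror image (upper and lower, over and under exchanged, all twists negated) is also allowed. The 4-1 move is the inverse. - 2-3 move: let a vertex with edges $A,B,C$ at west, north, east be joined by an edge $e$ of twist $0$, going south, to a second vertex with edges $A',B',C'$ at west, south, east; let $e,B,B'$ be lower and $A,C,A',C'$ upper at their vertices. These are replaced by three vertices $a=(-1,-\tfrac14)$, $b=(0,\tfrac14)$, $c=(1,-\tfrac14)$. At $a$ the edges $A$ (north) and $A'$ (south) are upper, and at $c$ the edges $C$ (north) and $C'$ (south) are upper; at $b$ the edges $B$ (north) and $B'$ (south) are lower. An edge of twist $0$ leaves $a$ to the east, passes over $B'$ and enters $c$ from the west. An edge of twist $+3$ leaves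 $b$ to the east, passes under $C$ and enters $c$ from the east; an edge of twist $-3$ leaves $b$ to the west, passes under $A$ and enters $a$ from the west. The twists of $A,A',C,C'$ change by $-2,+2,+2,-2$. The mirror image is also allowed. The 3-2 move is the inverse. **Lemma.** For every diagram $D$ of a framed knotted 4-regular graph $G$ that has a 3-line graph, the link $L(D)$ is well defined (it exists and is unique). If $D$ and $D'$ are related by a finite sequence of planar isotopies, generalized Reidemeister moves and Pachner moves with twists, then $L(D)=L(D')$. In particular $L(G)=L(D)$ does not depend on the diagram $D$ of $G$, and it is unchanged by the Pachner moves 1-4, 4-1, 2-3 and 3-2. -/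

import Mathlib

/-!
# Framed knotted 4-regular graphs, their 3-line graphs and the link `L(G)`

Diagrams in the plane are written in Morse position, read from bottom to top: a diagram is a
list of slices `(i, p)`, where the elementary piece `p` is placed so that exactly `i` strands
pass on its left, and every other strand runs vertically.  Planar isotopy is generated by
exchanging the heights of distant pieces, by straightening zigzags, and by turning a crossing
or a vertex through a quarter turn.
-/

namespace FramedGraph

/-! ## Words of slices -/

/-- A word of slices over the elementary pieces `P`. -/
abbrev Word (P : Type) := List (ℕ × P)

/-- Place `k` further vertical strands on the left of a word. -/
def Word.shift {P : Type} (k : ℕ) (w : Word P) : Word P :=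
  w.map fun s => (k + s.1, s.2)

/-- The numbers of strands below and above an elementary piece. -/
class Arity (P : Type) where
  src : P → ℕ
  tgt : P → ℕ

open Arity

/-- One elementary change of a word: a local move `l ↔ r` of the list `R`, carried out somewhere
in the diagram, or the exchange of the heights of two pieces lying side by side. -/
inductive Word.Step {P : Type} [Arity P] (R : Word P → Word P → Prop) :
    Word P → Word P → Prop
  | move (u v : Word P) (k : ℕ) {l r : Word P} (h : R l r) :
      Word.Step R (u ++ l.shift k ++ v) (u ++ r.shift k ++ v)
  | far (u v : Word P) (p q : P) (i k : ℕ) :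
      Word.Step R (u ++ [(i, p), (i + tgt p + k, q)] ++ v)
        (u ++ [(i + src p + k, q), (i, p)] ++ v)

/-! ## Links -/

/-- Elementary pieces of an unoriented link diagram: minimum, maximum and crossing.
In `cross s` the strand from bottom left to top right is the over-strand if `s = true` and the
under-strand if `s = false`. -/
inductive LinkPiece
  | cup
  | cap
  | cross (s : Bool)

instance : Arity LinkPiece where
  src p := match p with
    | .cup => 0
    | .cap => 2
    | .cross _ => 2
  tgt p := match p with
    | .cup => 2
    | .cap => 0
    | .cross _ => 2

/-- `LinkTyped m w n`: the word `w` is a diagram with `m` strands at the bottom and `n` strands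
at the top. -/
inductive LinkTyped : ℕ → Word LinkPiece → ℕ → Prop
  | nil (n : ℕ) : LinkTyped n [] n
  | cons (i k : ℕ) (p : LinkPiece) (w : Word LinkPiece) (n : ℕ) :
      LinkTyped (i + tgt p + k) w n → LinkTyped (i + src p + k) ((i, p) :: w) n

/-- A link diagram: a word without strands at the bottom and at the top. -/
def LinkDiagram := { w : Word LinkPiece // LinkTyped 0 w 0 }

/-- The local moves of link diagrams: planar isotopy and the three Reidemeister moves. -/
inductive LinkMove : Word LinkPiece → Word LinkPiece → Prop
  | zigzagRight : LinkMove [(1, .cup), (0, .cap)] []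
  | zigzagLeft : LinkMove [(0, .cup), (1, .cap)] []
  | rotateLeft (s : Bool) :
      LinkMove [(0, .cup), (1, .cross s), (2, .cap)] [(0, .cross (!s))]
  | rotateRight (s : Bool) :
      LinkMove [(2, .cup), (1, .cross s), (0, .cap)] [(0, .cross (!s))]
  | rIRight (s : Bool) : LinkMove [(1, .cup), (0, .cross s), (1, .cap)] []
  | rILeft (s : Bool) : LinkMove [(0, .cup), (1, .cross s), (0, .cap)] []
  | rII (s : Bool) : LinkMove [(0, .cross s), (0, .cross (!s))] []
  | rIII (s t u : Bool) (h : s = t ∨ t = u) :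
      LinkMove [(0, .cross s), (1, .cross t), (0, .cross u)]
        [(1, .cross u), (0, .cross t), (1, .cross s)]

/-- One planar isotopy or Reidemeister move between link diagrams. -/
def LinkDiagram.Move (M N : LinkDiagram) : Prop := Word.Step LinkMove M.1 N.1

/-- Links: link diagrams up to the equivalence relation generated by planar isotopy and the
Reidemeister moves. -/
def Link := Quot LinkDiagram.Move

/-- The link of a diagram. -/
def LinkDiagram.toLink (M : LinkDiagram) : Link := Quot.mk _ M

theorem LinkTyped.append {m : ℕ} {w : Word LinkPiece} {n : ℕ} (h : LinkTyped m w n)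
    {w' : Word LinkPiece} {n' : ℕ} (h' : LinkTyped n w' n') : LinkTyped m (w ++ w') n' := by
  induction h with
  | nil n => exact h'
  | cons i k p w n _ ih => exact .cons i k p _ _ (ih h')

/-- Add to a link diagram a separate circle without crossings, that is, an unknotted component
that is not linked with the rest. -/
def LinkDiagram.addCircle (M : LinkDiagram) : LinkDiagram :=
  ⟨M.1 ++ [(0, .cup), (0, .cap)],
    M.2.append (.cons 0 0 .cup _ _ (.cons 0 0 .cap _ _ (.nil 0)))⟩

/-- The link has no unlinked unknotted component. -/
def Link.IsReduced (K : Link) : Prop := ∀ N : LinkDiagram, K ≠ N.addCircle.toLink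

/-- `K.IsReductionOf K'`: the link `K` is obtained from `K'` by the removal of all unlinked
unknotted components. -/
def Link.IsReductionOf (K K' : Link) : Prop :=
  K.IsReduced ∧ ∃ (M : LinkDiagram) (n : ℕ),
    K = M.toLink ∧ K' = (LinkDiagram.addCircle^[n] M).toLink

/-! ## Diagrams of framed knotted 4-regular graphs -/

/-- The level of a framed strand after a twist by `t` units of `π / 3`. -/
def turn (c : Bool) (t : ℤ) : Bool := if Even t then c else !c

/-- Elementary pieces of a diagram of a framed 4-regular graph.

A framed edge has a triangular cross-section, whose three sides give the three lines of a leg.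
The side that gives the middle line faces either the viewer (level `true`, "high") or the opposite
direction (level `false`, "low").  The level is constant along an edge except at its twists, and
changes at every unit `π / 3` of twist; at a vertex the two opposite edges above the projection
plane have level `true`, the two below have level `false`.

* `cup c`, `cap c`: minimum and maximum of an edge of level `c`;
* `cross s c d`: crossing of two edges, where the edge of level `c` goes from bottom left to top
  right, the edge of level `d` from bottom right to top left, and the former passes over the
  latter if `s = true` and under it if `s = false`;
* `vertex s`: a vertex, where the opposite pair of edges at the bottom left and the top right lies
  above the projection plane if `s = true` and below it if `s = false` (and the other pair below,
  or above);
* `twist c t`: a twist by `t` units on an edge of level `c` below the twist; positive twists are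
  right-handed.  The twist of an edge of the graph is the sum of the twists along it. -/
inductive GraphPiece
  | cup (c : Bool)
  | cap (c : Bool)
  | cross (s c d : Bool)
  | vertex (s : Bool)
  | twist (c : Bool) (t : ℤ)

namespace GraphPiece

/-- The levels of the strands below a piece. -/
def dom : GraphPiece → List Bool
  | cup _ => []
  | cap c => [c, c]
  | cross _ c d => [c, d]
  | vertex s => [s, !s]
  | twist c _ => [c]

/-- The levels of the strands above a piece. -/
def cod : GraphPiece → List Bool
  | cup c => [c, c]
  | cap _ => []
  | cross _ c d => [d, c]
  | vertex s => [!s, s]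
  | twist c t => [turn c t]

end GraphPiece

instance : Arity GraphPiece where
  src p := p.dom.length
  tgt p := p.cod.length

/-- `GraphTyped S w T`: the word `w` is a diagram with strands of levels `S` at the bottom and of
levels `T` at the top. -/
inductive GraphTyped : List Bool → Word GraphPiece → List Bool → Prop
  | nil (S : List Bool) : GraphTyped S [] S
  | cons (a b : List Bool) (p : GraphPiece) (w : Word GraphPiece) (T : List Bool) :
      GraphTyped (a ++ p.cod ++ b) w T → GraphTyped (a ++ p.dom ++ b) ((a.length, p) :: w) T

/-- A diagram of a framed knotted 4-regular graph that has a 3-line graph.  As the levels fit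
together along every edge, the twist of an edge is even if its two ends lie on the same side of
the projection plane (like vertex states), and odd otherwise (unlike vertex states). -/
def GraphDiagram := { w : Word GraphPiece // GraphTyped [] w [] }

/-! ## The 3-line graph -/

/-- The braid on three strands that replaces a twist by `t` on a leg of level `c`, read upwards:
`|t|` crossings of the same kind, alternately at the two places. -/
def braid (c : Bool) (t : ℤ) : Word LinkPiece :=
  (List.range t.natAbs).map fun j =>
    (((if c = decide (0 ≤ t) then 1 else 0) + j) % 2, .cross (decide (0 ≤ t)))

/-- The part of the 3-line graph that replaces an elementary piece: every edge becomes a leg of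
three parallel lines.  At a vertex the outer lines of neighbouring legs are joined, and the
middle lines of opposite legs are joined and cross as the vertex state tells. -/
def threeLine : GraphPiece → Word LinkPiece
  | .cup _ => [(0, .cup), (1, .cup), (2, .cup)]
  | .cap _ => [(2, .cap), (1, .cap), (0, .cap)]
  | .cross s _ _ =>
      [(2, .cross s), (3, .cross s), (4, .cross s),
       (1, .cross s), (2, .cross s), (3, .cross s),
       (0, .cross s), (1, .cross s), (2, .cross s)]
  | .vertex s => [(2, .cap), (1, .cross s), (2, .cup)]
  | .twist c t => braid c t

/-- The 3-line graph of a diagram. -/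
def threeLineWord (w : Word GraphPiece) : Word LinkPiece :=
  w.flatMap fun s => (threeLine s.2).shift (3 * s.1)

theorem LinkTyped.shift {m : ℕ} {w : Word LinkPiece} {n : ℕ} (h : LinkTyped m w n) (a b : ℕ) :
    LinkTyped (a + m + b) (w.shift a) (a + n + b) := by
  induction h with
  | nil n => exact .nil _
  | cons i k p w n _ ih =>
    have e₁ : a + (i + src p + k) + b = (a + i) + src p + (k + b) := by omega
    have e₂ : a + (i + tgt p + k) + b = (a + i) + tgt p + (k + b) := by omega
    rw [e₂] at ih
    rw [e₁]
    exact .cons (a + i) (k + b) p _ _ ih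

theorem linkTyped_crosses (w : Word LinkPiece) (n : ℕ)
    (h : ∀ x ∈ w, ∃ s, x.2 = LinkPiece.cross s ∧ x.1 + 2 ≤ n) : LinkTyped n w n := by
  induction w with
  | nil => exact .nil n
  | cons x w ih =>
    obtain ⟨i, p⟩ := x
    obtain ⟨s, hp, hi⟩ := h (i, p) (by simp)
    obtain ⟨k, rfl⟩ := Nat.exists_eq_add_of_le hi
    simp only at hp
    subst hp
    exact .cons i k (.cross s) w _ (ih fun x hx => h x (by simp [hx]))

theorem linkTyped_threeLine (p : GraphPiece) :
    LinkTyped (3 * p.dom.length) (threeLine p) (3 * p.cod.length) := by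
  cases p with
  | cup c => exact .cons 0 0 .cup _ _ (.cons 1 1 .cup _ _ (.cons 2 2 .cup _ _ (.nil 6)))
  | cap c => exact .cons 2 2 .cap _ _ (.cons 1 1 .cap _ _ (.cons 0 0 .cap _ _ (.nil 0)))
  | cross s c d => exact linkTyped_crosses _ 6 (by simp [threeLine])
  | vertex s =>
    exact .cons 2 2 .cap _ _ (.cons 1 1 (.cross s) _ _ (.cons 2 2 .cup _ _ (.nil 6)))
  | twist c t =>
    refine linkTyped_crosses _ 3 fun x hx => ?_
    simp only [threeLine, braid, List.mem_map] at hx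
    obtain ⟨j, -, rfl⟩ := hx
    exact ⟨_, rfl, by simp only; omega⟩

theorem linkTyped_threeLineWord {S : List Bool} {w : Word GraphPiece} {T : List Bool}
    (h : GraphTyped S w T) : LinkTyped (3 * S.length) (threeLineWord w) (3 * T.length) := by
  induction h with
  | nil S => exact .nil _
  | cons a b p w T _ ih =>
    have h₁ := (linkTyped_threeLine p).shift (3 * a.length) (3 * b.length)
    have e₁ : 3 * (a ++ p.dom ++ b).length
        = 3 * a.length + 3 * p.dom.length + 3 * b.length := by
      simp only [List.length_append]; ring
    have e₂ : 3 * (a ++ p.cod ++ b).length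
        = 3 * a.length + 3 * p.cod.length + 3 * b.length := by
      simp only [List.length_append]; ring
    rw [e₂] at ih
    rw [e₁]
    exact h₁.append ih

/-- The 3-line graph of a diagram, taken as a link diagram. -/
def GraphDiagram.threeLineGraph (D : GraphDiagram) : LinkDiagram :=
  ⟨threeLineWord D.1, linkTyped_threeLineWord D.2⟩

/-- `L(G)`, read off from a diagram `D` of `G`: the links that are obtained from the link of the
3-line graph by the removal of all unlinked unknotted components. -/
def GraphDiagram.L (D : GraphDiagram) : Set Link :=
  { K | K.IsReductionOf D.threeLineGraph.toLink }

/-! ## Moves of framed graph diagrams -/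

/-- The sign `1` for `true`, and `-1` for `false`. -/
def sgn (s : Bool) : ℤ := if s then 1 else -1

/-- Planar isotopy of framed graph diagrams; a twist is attached to its edge as a whole, and so
may be divided and be moved along the edge. -/
inductive GraphIsotopy : Word GraphPiece → Word GraphPiece → Prop
  | zigzagRight (c : Bool) : GraphIsotopy [(1, .cup c), (0, .cap c)] []
  | zigzagLeft (c : Bool) : GraphIsotopy [(0, .cup c), (1, .cap c)] []
  | rotateCrossLeft (s c d : Bool) :
      GraphIsotopy [(0, .cup d), (1, .cross s d c), (2, .cap d)] [(0, .cross (!s) c d)]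
  | rotateCrossRight (s c d : Bool) :
      GraphIsotopy [(2, .cup c), (1, .cross s d c), (0, .cap c)] [(0, .cross (!s) c d)]
  | rotateVertexLeft (s : Bool) :
      GraphIsotopy [(0, .cup s), (1, .vertex s), (2, .cap s)] [(0, .vertex (!s))]
  | rotateVertexRight (s : Bool) :
      GraphIsotopy [(2, .cup (!s)), (1, .vertex s), (0, .cap (!s))] [(0, .vertex (!s))]
  | twistZero (c : Bool) : GraphIsotopy [(0, .twist c 0)] []
  | twistAdd (c : Bool) (t u : ℤ) :
      GraphIsotopy [(0, .twist c t), (0, .twist (turn c t) u)] [(0, .twist c (t + u))]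
  | twistCup (c : Bool) (t : ℤ) :
      GraphIsotopy [(0, .cup c), (0, .twist c t)] [(0, .cup (turn c t)), (1, .twist (turn c t) t)]
  | twistCap (c : Bool) (t : ℤ) :
      GraphIsotopy [(0, .twist c t), (0, .cap (turn c t))] [(1, .twist (turn c t) t), (0, .cap c)]
  | twistCrossLeft (s c d : Bool) (t : ℤ) :
      GraphIsotopy [(0, .twist c t), (0, .cross s (turn c t) d)]
        [(0, .cross s c d), (1, .twist c t)]
  | twistCrossRight (s c d : Bool) (t : ℤ) :
      GraphIsotopy [(1, .twist d t), (0, .cross s c (turn d t))]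
        [(0, .cross s c d), (0, .twist d t)]

/-- A curl in an edge of level `c`, turning clockwise (`k = true`) or anticlockwise
(`k = false`), with a positive (`s = true`) or negative (`s = false`) crossing. -/
def curl (k s c : Bool) : Word GraphPiece :=
  if k then [(1, .cup c), (0, .cross s c c), (1, .cap c)]
  else [(0, .cup c), (1, .cross s c c), (0, .cap c)]

/-- The generalized Reidemeister moves of framed graph diagrams. -/
inductive GraphReidemeister : Word GraphPiece → Word GraphPiece → Prop
  /-- Two successive curls of opposite framing are created or removed. -/
  | rI (k k' s c : Bool) : GraphReidemeister (curl k s c ++ curl k' (!s) c) []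
  | rII (s c d : Bool) : GraphReidemeister [(0, .cross s c d), (0, .cross (!s) d c)] []
  | rIII (s t u a b c : Bool) (h : s = t ∨ t = u) :
      GraphReidemeister [(0, .cross s a b), (1, .cross t a c), (0, .cross u b c)]
        [(1, .cross u b c), (0, .cross t a c), (1, .cross s a b)]
  /-- An edge is moved over or under a vertex. -/
  | rIVLeft (s a v : Bool) :
      GraphReidemeister [(0, .cross s a v), (1, .cross s a (!v)), (0, .vertex v)]
        [(1, .vertex v), (0, .cross s a (!v)), (1, .cross s a v)]
  | rIVRight (s a v : Bool) :
      GraphReidemeister [(1, .cross s (!v) a), (0, .cross s v a), (1, .vertex v)]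
        [(0, .vertex v), (1, .cross s v a), (0, .cross s (!v) a)]
  /-- A vertex is rotated around one of its edges, so that it changes its state and two
  neighbouring edges cross; these two edges are twisted by `± 2`, the other two by `∓ 1`. -/
  | rV (s : Bool) :
      GraphReidemeister [(0, .vertex s)]
        [(0, .twist s (-sgn s)), (1, .twist (!s) (-sgn s)),
         (0, .vertex (!s)), (0, .cross s s (!s)),
         (0, .twist (!s) (2 * sgn s)), (1, .twist s (2 * sgn s))]

/-- The graph Pachner moves with twists (to be read in both directions). -/
inductive GraphPachner : Word GraphPiece → Word GraphPiece → Prop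
  /-- The 1-4 move and the 4-1 move. -/
  | oneFour (s : Bool) :
      GraphPachner [(0, .vertex s)]
        [(1, .cup (!s)), (0, .vertex s),
         (4, .cup s), (3, .vertex (!s)),
         (2, .twist (!s) (sgn s)), (2, .cap s),
         (1, .cross s s (!s)),
         (0, .twist (!s) (-sgn s)), (3, .twist s (-sgn s)),
         (2, .cup s), (3, .twist s (sgn s)),
         (0, .vertex s), (1, .cap s),
         (1, .vertex (!s)), (2, .cap (!s))]
  /-- The 2-3 move and the 3-2 move; the bottom ends are `A'`, `B'`, `C'`, the top ends are
  `A`, `B`, `C`, and the common edge of the two vertices on the left has twist zero. -/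
  | twoThree (s : Bool) :
      GraphPachner
        [(0, .vertex s), (1, .cap s), (1, .cup s), (0, .vertex (!s))]
        [(0, .twist s (2 * sgn s)), (2, .twist s (-2 * sgn s)),
         (1, .cup (!s)), (0, .vertex s),
         (5, .cup (!s)), (4, .vertex s),
         (2, .cross s (!s) (!s)), (3, .cap (!s)),
         (0, .cross (!s) (!s) s), (3, .cross s s (!s)),
         (1, .twist (!s) (-3 * sgn s)), (3, .twist (!s) (3 * sgn s)),
         (1, .vertex s), (2, .cap s),
         (0, .twist s (-2 * sgn s)), (2, .twist s (2 * sgn s))]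

/-- The local moves of framed graph diagrams. -/
inductive GraphMove : Word GraphPiece → Word GraphPiece → Prop
  | isotopy {l r : Word GraphPiece} (h : GraphIsotopy l r) : GraphMove l r
  | reidemeister {l r : Word GraphPiece} (h : GraphReidemeister l r) : GraphMove l r
  | pachner {l r : Word GraphPiece} (h : GraphPachner l r) : GraphMove l r

/-- One planar isotopy, generalized Reidemeister move or Pachner move between diagrams. -/
def GraphDiagram.Move (D D' : GraphDiagram) : Prop := Word.Step GraphMove D.1 D'.1

end FramedGraph

/-!
The 3-line graph turns every move of framed graph diagrams into an isotopy of link diagrams, up to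
separate circles; and the link that is left after the removal of all separate circles depends only on
the isotopy class of a link diagram.

For the first part, words are considered as tangles (`Isotopic`), so that it is enough to look at the
local moves.  A twist is a braid of alternating crossings of one kind, which may be extended or
shortened at its end, and which slides along a leg through extrema and crossings one crossing at a
time (`isotopic_braid_add`, `isotopic_cup_braid`, `isotopic_braid_cap`, `isotopic_braid_cross_left`,
`isotopic_braid_cross_right`).  For each of the other moves, both tangles simplify to the same one by
an explicit sequence of isotopies, Reidemeister moves and removals of circles.  Such a sequence is a
list of rules, applied up to exchanges of heights (`rewriteAt`); a list is checked by computation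
(`agree`), and `agree_sound` turns the check into an isotopy.  The result is `isotopic_threeLineWord`.

For the second part, colour the components of a link diagram with two colours and consider for each
colour the diagram that is left when the strands of the other colour are deleted.  A local move of
link diagrams carries colourings to colourings bijectively, and the deletion of strands turns it into
a local move or into nothing.  So an isotopy of two diagrams carries every colouring of the first to a
colouring of the second with isotopic sublinks, and the number of colourings, which is a power of `2`
with the number of components as exponent, is an invariant (`Isotopic.colourings`).  If `u` with `n`
circles is isotopic to `v` with `m` circles, and `u` and `v` have no separate circle, colour `u` by
`true` and the `n` circles by `false`.  In the corresponding colouring all of the `m` circles are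
`false`, since otherwise `u` would have a separate circle.  The sublinks of colour `false` then have
`2 ^ n` colourings on one side and a multiple of `2 ^ m` on the other side; so `m ≤ n`, and by
symmetry `m = n`.  It follows that no component of `v` is `false`, and `u` is isotopic to `v`
(`NoCircle.isotopic`).  The number of colourings also bounds the number of circles that can be
removed (`exists_noCircle`).
-/

namespace FramedGraph

open Arity

/-! ### Isotopy of tangle words -/

theorem linkTyped_nil_iff {m n : ℕ} : LinkTyped m [] n ↔ m = n :=
  ⟨fun h => by cases h; rfl, fun h => h ▸ .nil _⟩

theorem linkTyped_cons_iff {m n i : ℕ} {p : LinkPiece} {w : Word LinkPiece} :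
    LinkTyped m ((i, p) :: w) n ↔ i + src p ≤ m ∧ LinkTyped (m - src p + tgt p) w n := by
  constructor
  · intro h
    cases h with
    | cons i k p w n h =>
      refine ⟨by omega, ?_⟩
      rwa [show i + src p + k - src p + tgt p = i + tgt p + k by omega]
  · rintro ⟨h, h'⟩
    obtain ⟨k, rfl⟩ := Nat.exists_eq_add_of_le h
    rw [show i + src p + k - src p + tgt p = i + tgt p + k by omega] at h'
    exact .cons i k p w n h'

theorem linkTyped_append_iff {m n : ℕ} {u v : Word LinkPiece} :
    LinkTyped m (u ++ v) n ↔ ∃ p, LinkTyped m u p ∧ LinkTyped p v n := by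
  constructor
  · intro h
    induction u generalizing m with
    | nil => exact ⟨m, .nil _, h⟩
    | cons x u ih =>
      rw [List.cons_append, linkTyped_cons_iff] at h
      obtain ⟨p, hp, hv⟩ := ih h.2
      exact ⟨p, linkTyped_cons_iff.2 ⟨h.1, hp⟩, hv⟩
  · rintro ⟨p, hu, hv⟩
    exact hu.append hv

theorem LinkTyped.unique {m n n' : ℕ} {w : Word LinkPiece} (h : LinkTyped m w n)
    (h' : LinkTyped m w n') : n = n' := by
  induction w generalizing m with
  | nil => rw [linkTyped_nil_iff] at h h'; omega
  | cons x w ih =>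
    rw [linkTyped_cons_iff] at h h'
    exact ih h.2 h'.2

section Words

variable {P : Type}

@[simp] theorem Word.shift_nil (k : ℕ) : Word.shift k ([] : Word P) = [] := rfl

@[simp] theorem Word.shift_cons (k : ℕ) (x : ℕ × P) (w : Word P) :
    Word.shift k (x :: w) = (k + x.1, x.2) :: Word.shift k w := rfl

@[simp] theorem Word.shift_append (k : ℕ) (u v : Word P) :
    (u ++ v : Word P).shift k = u.shift k ++ v.shift k := List.map_append

theorem Word.shift_shift (j k : ℕ) (w : Word P) :
    (w.shift j).shift k = w.shift (k + j) := by
  simp [Word.shift, Function.comp_def, Nat.add_assoc]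

@[simp] theorem Word.shift_zero (w : Word P) : w.shift 0 = w := by
  simp [Word.shift]

variable [Arity P] {R : Word P → Word P → Prop}

theorem Word.Step.context {w w' : Word P} (h : Word.Step R w w') (u v : Word P) :
    Word.Step R (u ++ w ++ v) (u ++ w' ++ v) := by
  cases h with
  | move u' v' k h => simpa using Word.Step.move (u ++ u') (v' ++ v) k h
  | far u' v' p q i k => simpa using Word.Step.far (R := R) (u ++ u') (v' ++ v) p q i k

theorem Word.Step.shift {w w' : Word P} (h : Word.Step R w w') (a : ℕ) :
    Word.Step R (w.shift a) (w'.shift a) := by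
  cases h with
  | move u v k h =>
    simp only [Word.shift_append, Word.shift_shift]
    exact .move _ _ _ h
  | far u v p q i k =>
    have := Word.Step.far (R := R) (u.shift a) (v.shift a) p q (a + i) k
    simpa [Nat.add_assoc] using this

theorem Word.Step.mono {R' : Word P → Word P → Prop} (hR : ∀ l r, R l r → R' l r)
    {w w' : Word P} (h : Word.Step R w w') : Word.Step R' w w' := by
  cases h with
  | move u v k h => exact .move u v k (hR _ _ h)
  | far u v p q i k => exact .far u v p q i k

/-- All pieces of the word `w` find their strands if there are `m` strands at the bottom. -/
def Word.Fits : ℕ → Word P → Prop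
  | _, [] => True
  | m, (i, p) :: w => i + src p ≤ m ∧ Word.Fits (m - src p + tgt p) w

theorem Word.Fits.of_append {m : ℕ} {u v : Word P} (h : Word.Fits m (u ++ v)) :
    Word.Fits m u := by
  induction u generalizing m with
  | nil => trivial
  | cons x u ih => exact ⟨h.1, ih h.2⟩

end Words

theorem LinkTyped.fits {m n : ℕ} {w : Word LinkPiece} (h : LinkTyped m w n) :
    Word.Fits m w := by
  induction w generalizing m with
  | nil => trivial
  | cons x w ih =>
    rw [linkTyped_cons_iff] at h
    exact ⟨h.1, ih h.2⟩

/-- Equivalence of tangle words with `m` strands at the bottom and `n` strands at the top,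
generated by the local moves `R` and the exchange of heights.  All intermediate words are
required to be diagrams with `m` and `n` strands. -/
def Isotopic (R : Word LinkPiece → Word LinkPiece → Prop) (m n : ℕ) :
    Word LinkPiece → Word LinkPiece → Prop :=
  Relation.EqvGen fun w w' => LinkTyped m w n ∧ LinkTyped m w' n ∧ Word.Step R w w'

theorem eqvGen_map {α β : Type*} {r : α → α → Prop} {s : β → β → Prop} (f : α → β)
    (hf : ∀ a b, r a b → s (f a) (f b)) {a b : α} (h : Relation.EqvGen r a b) :
    Relation.EqvGen s (f a) (f b) := by
  induction h with
  | rel x y h => exact .rel _ _ (hf _ _ h)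
  | refl x => exact .refl _
  | symm x y _ ih => exact ih.symm
  | trans x y z _ _ ih₁ ih₂ => exact ih₁.trans _ _ _ ih₂

namespace Isotopic

variable {R : Word LinkPiece → Word LinkPiece → Prop} {m n p : ℕ} {u v w w' : Word LinkPiece}

theorem refl (w : Word LinkPiece) : Isotopic R m n w w := Relation.EqvGen.refl w

theorem of_eq (h : w = w') : Isotopic R m n w w' := h ▸ refl w

theorem symm (h : Isotopic R m n w w') : Isotopic R m n w' w := Relation.EqvGen.symm _ _ h

theorem trans (h : Isotopic R m n u v) (h' : Isotopic R m n v w) : Isotopic R m n u w :=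
  Relation.EqvGen.trans _ _ _ h h'

theorem of_step (hw : LinkTyped m w n) (hw' : LinkTyped m w' n) (h : Word.Step R w w') :
    Isotopic R m n w w' := .rel _ _ ⟨hw, hw', h⟩

theorem append_left (hu : LinkTyped m u p) (h : Isotopic R p n w w') :
    Isotopic R m n (u ++ w) (u ++ w') :=
  eqvGen_map _ (fun _ _ h => ⟨hu.append h.1, hu.append h.2.1, by
    simpa using h.2.2.context u []⟩) h

theorem append_right (h : Isotopic R m p w w') (hv : LinkTyped p v n) :
    Isotopic R m n (w ++ v) (w' ++ v) :=
  eqvGen_map (· ++ v) (fun _ _ h => ⟨h.1.append hv, h.2.1.append hv, by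
    simpa using h.2.2.context [] v⟩) h

theorem shift (h : Isotopic R m n w w') (a b : ℕ) :
    Isotopic R (a + m + b) (a + n + b) (w.shift a) (w'.shift a) :=
  eqvGen_map _ (fun _ _ h => ⟨h.1.shift a b, h.2.1.shift a b, h.2.2.shift a⟩) h

theorem mono {R' : Word LinkPiece → Word LinkPiece → Prop} (hR : ∀ l r, R l r → R' l r)
    (h : Isotopic R m n w w') : Isotopic R' m n w w' :=
  eqvGen_map id (fun _ _ h => ⟨h.1, h.2.1, h.2.2.mono hR⟩) h

theorem typed_iff (h : Isotopic R m n w w') : LinkTyped m w n ↔ LinkTyped m w' n := by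
  induction h with
  | rel x y h => exact iff_of_true h.1 h.2.1
  | refl x => rfl
  | symm x y _ ih => exact ih.symm
  | trans x y z _ _ ih₁ ih₂ => exact ih₁.trans ih₂

end Isotopic

/-- The words `l` and `r` are isotopic on the least number `m` of strands on which `l` makes
sense, so that `l` may be replaced by `r` wherever it occurs in a diagram. -/
def Replaceable (R : Word LinkPiece → Word LinkPiece → Prop) (l r : Word LinkPiece) : Prop :=
  ∃ m n, (∀ p k, Word.Fits p (l.shift k) → k + m ≤ p) ∧ LinkTyped m l n ∧ Isotopic R m n l r

/-- A replaceable word may be replaced anywhere in a diagram, with any number of strands on its left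
and on its right. -/
theorem Replaceable.isotopic {R : Word LinkPiece → Word LinkPiece → Prop}
    {l r : Word LinkPiece} (h : Replaceable R l r) {m n k : ℕ} {u v : Word LinkPiece}
    (hw : LinkTyped m (u ++ l.shift k ++ v) n) :
    Isotopic R m n (u ++ l.shift k ++ v) (u ++ r.shift k ++ v) := by
  obtain ⟨m₀, n₀, hfit, hl, hlr⟩ := h
  obtain ⟨q, hul, hv⟩ := linkTyped_append_iff.1 hw
  obtain ⟨p, hu, hlk⟩ := linkTyped_append_iff.1 hul
  obtain ⟨b, rfl⟩ := Nat.exists_eq_add_of_le (hfit p k hlk.fits)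
  obtain rfl := hlk.unique (hl.shift k b)
  exact .append_right (.append_left hu (hlr.shift k b)) hv

theorem linkTyped_far_iff {m n : ℕ} (u v : Word LinkPiece) (p q : LinkPiece) (i k : ℕ) :
    LinkTyped m (u ++ [(i, p), (i + tgt p + k, q)] ++ v) n ↔
      LinkTyped m (u ++ [(i + src p + k, q), (i, p)] ++ v) n := by
  simp only [linkTyped_append_iff, linkTyped_cons_iff, linkTyped_nil_iff]
  constructor
  · rintro ⟨b, ⟨a, hu, h₁, h₂, h₃⟩, hv⟩
    exact ⟨b, ⟨a, hu, by omega, by omega, by omega⟩, hv⟩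
  · rintro ⟨b, ⟨a, hu, h₁, h₂, h₃⟩, hv⟩
    exact ⟨b, ⟨a, hu, by omega, by omega, by omega⟩, hv⟩

/-- Two words differ only by exchanges of the heights of pieces lying side by side. -/
def FarEq : Word LinkPiece → Word LinkPiece → Prop :=
  Relation.EqvGen (Word.Step fun _ _ => False)

namespace FarEq

variable {u v w w' : Word LinkPiece}

theorem refl (w : Word LinkPiece) : FarEq w w := Relation.EqvGen.refl w

theorem symm (h : FarEq w w') : FarEq w' w := Relation.EqvGen.symm _ _ h

theorem trans (h : FarEq u v) (h' : FarEq v w) : FarEq u w := Relation.EqvGen.trans _ _ _ h h'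

theorem context (h : FarEq w w') (u v : Word LinkPiece) : FarEq (u ++ w ++ v) (u ++ w' ++ v) :=
  eqvGen_map (fun x => u ++ x ++ v) (fun _ _ h => h.context u v) h

theorem append_left (u : Word LinkPiece) (h : FarEq w w') : FarEq (u ++ w) (u ++ w') := by
  simpa using h.context u []

theorem append_right (h : FarEq w w') (v : Word LinkPiece) : FarEq (w ++ v) (w' ++ v) := by
  simpa using h.context [] v

theorem isotopic {R : Word LinkPiece → Word LinkPiece → Prop} {m n : ℕ} (h : FarEq w w')
    (hw : LinkTyped m w n) : Isotopic R m n w w' := by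
  have key : (LinkTyped m w n ↔ LinkTyped m w' n) ∧
      (LinkTyped m w n → Isotopic R m n w w') := by
    clear hw
    induction h with
    | rel x y h =>
      have hxy : LinkTyped m x n ↔ LinkTyped m y n := by
        cases h with
        | move _ _ _ h => exact h.elim
        | far u v p q i k => exact linkTyped_far_iff u v p q i k
      exact ⟨hxy, fun hx => .of_step hx (hxy.1 hx) (h.mono fun _ _ => False.elim)⟩
    | refl x => exact ⟨Iff.rfl, fun _ => .refl x⟩
    | symm x y _ ih => exact ⟨ih.1.symm, fun hy => (ih.2 (ih.1.2 hy)).symm⟩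
    | trans x y z _ _ ih₁ ih₂ =>
      exact ⟨ih₁.1.trans ih₂.1, fun hx => (ih₁.2 hx).trans (ih₂.2 (ih₁.1.1 hx))⟩
  exact key.2 hw

end FarEq

/-! ### A rewriting procedure for tangle words -/

instance : DecidableEq LinkPiece
  | .cup, .cup => isTrue rfl
  | .cap, .cap => isTrue rfl
  | .cross s, .cross t => decidable_of_iff (s = t) (by simp)
  | .cup, .cap => isFalse nofun
  | .cup, .cross _ => isFalse nofun
  | .cap, .cup => isFalse nofun
  | .cap, .cross _ => isFalse nofun
  | .cross _, .cup => isFalse nofun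
  | .cross _, .cap => isFalse nofun

/-- Exchange the slice `x` with the slice `y` above it, if their pieces lie side by side. The
result is the new lower slice followed by the new upper one. -/
def exchange (x y : ℕ × LinkPiece) : Option ((ℕ × LinkPiece) × (ℕ × LinkPiece)) :=
  if x.1 + tgt x.2 ≤ y.1 then some ((y.1 - tgt x.2 + src x.2, y.2), x)
  else if y.1 + src y.2 ≤ x.1 then some (y, (x.1 - src y.2 + tgt y.2, x.2))
  else none

theorem exchange_sound {x y y' x' : ℕ × LinkPiece} (h : exchange x y = some (y', x')) :
    FarEq [x, y] [y', x'] := by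
  obtain ⟨i, p⟩ := x
  obtain ⟨j, q⟩ := y
  unfold exchange at h
  split_ifs at h with h₁ h₂
  · simp only [Option.some.injEq, Prod.mk.injEq] at h
    obtain ⟨rfl, rfl⟩ := h
    obtain ⟨k, hk⟩ := Nat.exists_eq_add_of_le h₁
    simp only at hk
    subst hk
    rw [show i + tgt p + k - tgt p + src p = i + src p + k by omega]
    exact .rel _ _ (by simpa using Word.Step.far [] [] p q i k)
  · simp only [Option.some.injEq, Prod.mk.injEq] at h
    obtain ⟨rfl, rfl⟩ := h
    obtain ⟨k, hk⟩ := Nat.exists_eq_add_of_le h₂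
    simp only at hk
    subst hk
    rw [show j + src q + k - src q + tgt q = j + tgt q + k by omega]
    exact FarEq.symm (.rel _ _ (by simpa using Word.Step.far [] [] q p j k))

/-- Lower the slice `y`, which lies above the word `w`, to the bottom of `w`, if it is not held up
by any piece. -/
def lower : Word LinkPiece → ℕ × LinkPiece → Option ((ℕ × LinkPiece) × Word LinkPiece)
  | [], y => some (y, [])
  | x :: w, y =>
    (lower w y).bind fun a => (exchange x a.1).map fun b => (b.1, b.2 :: a.2)

theorem lower_sound {w w' : Word LinkPiece} {y y' : ℕ × LinkPiece}
    (h : lower w y = some (y', w')) : FarEq (w ++ [y]) (y' :: w') := by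
  induction w generalizing y' w' with
  | nil =>
    simp only [lower, Option.some.injEq, Prod.mk.injEq] at h
    obtain ⟨rfl, rfl⟩ := h
    exact .refl _
  | cons x w ih =>
    simp only [lower, Option.bind_eq_some_iff, Option.map_eq_some_iff] at h
    obtain ⟨⟨y₁, w₁⟩, h₁, ⟨y₂, x₂⟩, h₂, h₃⟩ := h
    simp only [Prod.mk.injEq] at h₃
    obtain ⟨rfl, rfl⟩ := h₃
    exact ((ih h₁).append_left [x]).trans ((exchange_sound h₂).append_right w₁)

/-- Replace the word `blk` by the copy of `r` in the same place, if `blk` is a copy of `l`. -/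
def replaceBlock (l r pre blk post : Word LinkPiece) : Option (Word LinkPiece) :=
  let k := (blk.headD (0, .cup)).1 - (l.headD (0, .cup)).1
  if blk = l.shift k then some (pre ++ r.shift k ++ post) else none

/-- Collect a copy of `l` from the word `pre ++ blk ++ aft ++ rest`, where `blk` is the part of it
that is already found, and replace it by `r`.  The slices of `rest` are taken one by one.  A slice
is added to `blk` if it can be lowered to `blk` and is the next one of `l`; it is put into `pre`
if it can be lowered below `blk`; otherwise it is put into `aft`. -/
def collect (l r : Word LinkPiece) :
    (pre blk aft rest : Word LinkPiece) → Option (Word LinkPiece)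
  | pre, blk, aft, [] => replaceBlock l r pre blk aft
  | pre, blk, aft, y :: rest =>
    if blk.length = l.length then replaceBlock l r pre blk (aft ++ y :: rest)
    else
      match lower aft y with
      | none => collect l r pre blk (aft ++ [y]) rest
      | some (y', aft') =>
        let k := (blk.headD (0, .cup)).1 - (l.headD (0, .cup)).1
        if (l.shift k)[blk.length]? = some y' then collect l r pre (blk ++ [y']) aft' rest
        else
          match lower blk y' with
          | none => collect l r pre blk (aft ++ [y]) rest
          | some (y'', blk') => collect l r (pre ++ [y'']) blk' aft' rest

theorem replaceBlock_sound {l r pre blk post w : Word LinkPiece}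
    (h : replaceBlock l r pre blk post = some w) :
    ∃ k u v, FarEq (pre ++ blk ++ post) (u ++ l.shift k ++ v) ∧ w = u ++ r.shift k ++ v := by
  unfold replaceBlock at h
  simp only at h
  split_ifs at h with h₁
  simp only [Option.some.injEq] at h
  exact ⟨_, pre, post, by rw [← h₁]; exact .refl _, h.symm⟩

theorem collect_sound {l r pre blk aft rest w : Word LinkPiece}
    (h : collect l r pre blk aft rest = some w) :
    ∃ k u v, FarEq (pre ++ blk ++ aft ++ rest) (u ++ l.shift k ++ v) ∧
      w = u ++ r.shift k ++ v := by
  induction rest generalizing pre blk aft with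
  | nil => simpa [collect] using replaceBlock_sound h
  | cons y rest ih =>
    unfold collect at h
    split_ifs at h with h₁
    · simpa using replaceBlock_sound h
    · have hstay : collect l r pre blk (aft ++ [y]) rest = some w →
          ∃ k u v, FarEq (pre ++ blk ++ aft ++ y :: rest) (u ++ l.shift k ++ v) ∧
            w = u ++ r.shift k ++ v := fun h => by simpa using ih h
      split at h
      · exact hstay h
      · rename_i y' aft' hy'
        have e₁ : FarEq (pre ++ blk ++ aft ++ y :: rest)
            (pre ++ blk ++ y' :: aft' ++ rest) := by
          simpa using (lower_sound hy').context (pre ++ blk) rest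
        simp only at h
        split_ifs at h
        · obtain ⟨k, u, v, hk, hw⟩ := ih h
          exact ⟨k, u, v, e₁.trans (by simpa using hk), hw⟩
        · split at h
          · exact hstay h
          · rename_i y'' blk' hy''
            obtain ⟨k, u, v, hk, hw⟩ := ih h
            have e₂ : FarEq (pre ++ blk ++ y' :: aft' ++ rest)
                (pre ++ [y''] ++ blk' ++ aft' ++ rest) := by
              simpa using (lower_sound hy'').context pre (aft' ++ rest)
            exact ⟨k, u, v, e₁.trans (e₂.trans hk), hw⟩

/-- Replace by `r` a copy of `l` whose first piece is the `j`-th slice of the word `w`, after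
suitable exchanges of heights. -/
def rewriteAt (l r : Word LinkPiece) (j : ℕ) (w : Word LinkPiece) : Option (Word LinkPiece) :=
  match w.drop j with
  | [] => none
  | x :: rest => collect l r (w.take j) [x] [] rest

theorem rewriteAt_sound {R : Word LinkPiece → Word LinkPiece → Prop}
    {l r w w' : Word LinkPiece} {j m n : ℕ} (h : rewriteAt l r j w = some w')
    (hlr : Replaceable R l r) (hw : LinkTyped m w n) : Isotopic R m n w w' := by
  unfold rewriteAt at h
  split at h
  · simp at h
  · rename_i x rest hx
    obtain ⟨k, u, v, hk, rfl⟩ := collect_sound h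
    have e : w.take j ++ [x] ++ [] ++ rest = w := by
      rw [List.append_nil, List.append_assoc, List.singleton_append, ← hx, List.take_append_drop]
    rw [e] at hk
    have h₁ := hk.isotopic (R := R) hw
    exact h₁.trans (hlr.isotopic (h₁.typed_iff.1 hw))

/-- All ways to lower some slice of a word to the bottom. -/
def fronts : Word LinkPiece → List ((ℕ × LinkPiece) × Word LinkPiece)
  | [] => []
  | y :: w =>
    (y, w) :: (fronts w).filterMap fun a => (exchange y a.1).map fun b => (b.1, b.2 :: a.2)

theorem fronts_sound {w w' : Word LinkPiece} {x : ℕ × LinkPiece} (h : (x, w') ∈ fronts w) :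
    FarEq w (x :: w') := by
  induction w generalizing x w' with
  | nil => simp [fronts] at h
  | cons y w ih =>
    simp only [fronts, List.mem_cons, Prod.mk.injEq, List.mem_filterMap,
      Option.map_eq_some_iff] at h
    obtain ⟨rfl, rfl⟩ | ⟨⟨x₁, w₁⟩, h₁, ⟨x₂, y₂⟩, h₂, rfl, rfl⟩ := h
    · exact .refl _
    · exact ((ih h₁).append_left [y]).trans ((exchange_sound h₂).append_right w₁)

/-- Check that two words differ only by exchanges of heights. -/
def farEqb : Word LinkPiece → Word LinkPiece → Bool
  | [], w' => w'.isEmpty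
  | x :: w, w' => (fronts w').any fun a => decide (a.1 = x) && farEqb w a.2

theorem farEqb_sound {w w' : Word LinkPiece} (h : farEqb w w' = true) : FarEq w w' := by
  induction w generalizing w' with
  | nil => rw [farEqb, List.isEmpty_iff] at h; exact h ▸ .refl _
  | cons x w ih =>
    simp only [farEqb, List.any_eq_true, Bool.and_eq_true, decide_eq_true_eq] at h
    obtain ⟨⟨x', v⟩, hv, rfl, h⟩ := h
    exact ((ih h).append_left [x']).trans (fronts_sound hv).symm

/-! ### Derived moves of tangle words -/

theorem LinkMove.fits {l r : Word LinkPiece} (h : LinkMove l r) :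
    ∃ m n, (∀ p k, Word.Fits p (l.shift k) → k + m ≤ p) ∧ LinkTyped m l n ∧
      LinkTyped m r n := by
  cases h with
  | zigzagRight | zigzagLeft | rIRight | rILeft =>
    refine ⟨1, 1, fun p k h => ?_, ?_, ?_⟩
    · simp [Word.Fits, src, tgt] at h; omega
    all_goals simp [linkTyped_cons_iff, linkTyped_nil_iff, src, tgt]
  | rotateLeft | rotateRight | rII =>
    refine ⟨2, 2, fun p k h => ?_, ?_, ?_⟩
    · simp [Word.Fits, src, tgt] at h; omega
    all_goals simp [linkTyped_cons_iff, linkTyped_nil_iff, src, tgt]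
  | rIII =>
    refine ⟨3, 3, fun p k h => ?_, ?_, ?_⟩
    · simp [Word.Fits, src, tgt] at h; omega
    all_goals simp [linkTyped_cons_iff, linkTyped_nil_iff, src, tgt]

theorem LinkMove.replaceable {l r : Word LinkPiece} (h : LinkMove l r) :
    Replaceable LinkMove l r := by
  obtain ⟨m, n, hf, hl, hr⟩ := h.fits
  exact ⟨m, n, hf, hl, .of_step hl hr (by simpa using Word.Step.move [] [] 0 h)⟩

/-- A crossing next to a minimum slides around it. -/
theorem isotopic_cup_cross (s : Bool) : Isotopic LinkMove 1 3
    [(1, .cup), (0, .cross s)] [(0, .cup), (1, .cross (!s))] := by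
  -- After a quarter turn of the crossing, the minimum forms a zigzag with the new maximum.
  have h₁ := (LinkMove.rotateLeft (!s)).replaceable.isotopic (m := 1) (n := 3) (k := 0)
    (u := [(1, .cup)]) (v := []) (by simp [linkTyped_cons_iff, linkTyped_nil_iff, src, tgt])
  have h₂ := rewriteAt_sound (m := 1) (n := 3)
    (w := [(1, .cup), (0, .cup), (1, .cross (!s)), (2, .cap)])
    (w' := [(0, .cup), (1, .cross (!s))]) (j := 0) (by cases s <;> rfl)
    LinkMove.zigzagRight.replaceable
    (by simp [linkTyped_cons_iff, linkTyped_nil_iff, src, tgt])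
  simp only [Bool.not_not] at h₁
  exact h₁.symm.trans h₂

/-- A crossing next to a maximum slides around it. -/
theorem isotopic_cross_cap (s : Bool) : Isotopic LinkMove 3 1
    [(0, .cross s), (1, .cap)] [(1, .cross (!s)), (0, .cap)] := by
  -- After a quarter turn of the crossing, the maximum forms a zigzag with the new minimum.
  have h₁ := (LinkMove.rotateRight (!s)).replaceable.isotopic (m := 3) (n := 1) (k := 0)
    (u := []) (v := [(1, .cap)]) (by simp [linkTyped_cons_iff, linkTyped_nil_iff, src, tgt])
  have h₂ := rewriteAt_sound (m := 3) (n := 1)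
    (w := [(2, .cup), (1, .cross (!s)), (0, .cap), (1, .cap)])
    (w' := [(1, .cross (!s)), (0, .cap)]) (j := 0) (by cases s <;> rfl)
    LinkMove.zigzagLeft.replaceable
    (by simp [linkTyped_cons_iff, linkTyped_nil_iff, src, tgt])
  simp only [Bool.not_not] at h₁
  exact h₁.symm.trans h₂

theorem replaceable_cupLeft (s : Bool) : Replaceable LinkMove
    [(1, .cup), (0, .cross s)] [(0, .cup), (1, .cross (!s))] :=
  ⟨1, 3, fun p k h => by simp [Word.Fits, src, tgt] at h; omega,
    by simp [linkTyped_cons_iff, linkTyped_nil_iff, src, tgt], isotopic_cup_cross s⟩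

theorem replaceable_cupRight (s : Bool) : Replaceable LinkMove
    [(0, .cup), (1, .cross s)] [(1, .cup), (0, .cross (!s))] :=
  ⟨1, 3, fun p k h => by simp [Word.Fits, src, tgt] at h; omega,
    by simp [linkTyped_cons_iff, linkTyped_nil_iff, src, tgt],
    by simpa using (isotopic_cup_cross (!s)).symm⟩

theorem replaceable_capLeft (s : Bool) : Replaceable LinkMove
    [(0, .cross s), (1, .cap)] [(1, .cross (!s)), (0, .cap)] :=
  ⟨3, 1, fun p k h => by simp [Word.Fits, src, tgt] at h; omega,
    by simp [linkTyped_cons_iff, linkTyped_nil_iff, src, tgt], isotopic_cross_cap s⟩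

theorem replaceable_capRight (s : Bool) : Replaceable LinkMove
    [(1, .cross s), (0, .cap)] [(0, .cross (!s)), (1, .cap)] :=
  ⟨3, 1, fun p k h => by simp [Word.Fits, src, tgt] at h; omega,
    by simp [linkTyped_cons_iff, linkTyped_nil_iff, src, tgt],
    by simpa using (isotopic_cross_cap (!s)).symm⟩

/-- A kink at a minimum is removed. -/
theorem replaceable_cupKink (s : Bool) : Replaceable LinkMove
    [(0, .cup), (0, .cross s)] [(0, .cup)] := by
  refine ⟨0, 2, fun p k h => by simp [Word.Fits, src, tgt] at h; omega,
    by simp [linkTyped_cons_iff, linkTyped_nil_iff, src, tgt], ?_⟩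
  -- The minimum forms a zigzag with the maximum of a curl in the right strand.
  have h₁ := (LinkMove.rIRight (!s)).replaceable.isotopic (m := 0) (n := 2) (k := 1)
    (u := [(0, .cup)]) (v := []) (by simp [linkTyped_cons_iff, linkTyped_nil_iff, src, tgt])
  have h₂ := rewriteAt_sound (m := 0) (n := 2)
    (w := [(0, .cup), (2, .cup), (1, .cross (!s)), (2, .cap)])
    (w' := [(0, .cup), (2, .cup), (2, .cross s), (1, .cap)]) (j := 2) (by cases s <;> rfl)
    (replaceable_capLeft (!s))
    (by simp [linkTyped_cons_iff, linkTyped_nil_iff, src, tgt])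
  have h₃ := rewriteAt_sound (m := 0) (n := 2)
    (w := [(0, .cup), (2, .cup), (2, .cross s), (1, .cap)])
    (w' := [(0, .cup), (0, .cross s)]) (j := 0) (by cases s <;> rfl)
    LinkMove.zigzagLeft.replaceable
    (by simp [linkTyped_cons_iff, linkTyped_nil_iff, src, tgt])
  exact (h₂.trans h₃).symm.trans h₁

/-- A kink at a maximum is removed. -/
theorem replaceable_capKink (s : Bool) : Replaceable LinkMove
    [(0, .cross s), (0, .cap)] [(0, .cap)] := by
  refine ⟨2, 0, fun p k h => by simp [Word.Fits, src, tgt] at h; omega,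
    by simp [linkTyped_cons_iff, linkTyped_nil_iff, src, tgt], ?_⟩
  -- The minimum of a curl in the right strand forms a zigzag with the maximum.
  have h₁ := (LinkMove.rIRight (!s)).replaceable.isotopic (m := 2) (n := 0) (k := 1)
    (u := []) (v := [(0, .cap)]) (by simp [linkTyped_cons_iff, linkTyped_nil_iff, src, tgt])
  have h₂ := rewriteAt_sound (m := 2) (n := 0)
    (w := [(2, .cup), (1, .cross (!s)), (2, .cap), (0, .cap)])
    (w' := [(1, .cup), (2, .cross s), (2, .cap), (0, .cap)]) (j := 0) (by cases s <;> rfl)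
    (replaceable_cupLeft (!s))
    (by simp [linkTyped_cons_iff, linkTyped_nil_iff, src, tgt])
  have h₃ := rewriteAt_sound (m := 2) (n := 0)
    (w := [(1, .cup), (2, .cross s), (2, .cap), (0, .cap)])
    (w' := [(0, .cross s), (0, .cap)]) (j := 0) (by cases s <;> rfl)
    LinkMove.zigzagRight.replaceable
    (by simp [linkTyped_cons_iff, linkTyped_nil_iff, src, tgt])
  exact (h₂.trans h₃).symm.trans h₁

/-- The local moves of link diagrams, together with the removal of a separate circle. -/
inductive CircleMove : Word LinkPiece → Word LinkPiece → Prop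
  | move {l r : Word LinkPiece} (h : LinkMove l r) : CircleMove l r
  | circle : CircleMove [(0, .cup), (0, .cap)] []

theorem Replaceable.circleMove {l r : Word LinkPiece} (h : Replaceable LinkMove l r) :
    Replaceable CircleMove l r := by
  obtain ⟨m, n, hf, hl, hlr⟩ := h
  exact ⟨m, n, hf, hl, hlr.mono fun _ _ => .move⟩

/-- The replacements that are used to simplify a tangle word: straightening a zigzag, removing a
circle or a kink, sliding a crossing around an extremum, and the second and third Reidemeister
moves. -/
inductive Rule
  | zig
  | zag
  | circle
  | cupKink (s : Bool)
  | capKink (s : Bool)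
  | cupLeft (s : Bool)
  | cupRight (s : Bool)
  | capLeft (s : Bool)
  | capRight (s : Bool)
  | two (s : Bool)
  | three (s t u : Bool)
  | three' (s t u : Bool)

namespace Rule

/-- The word that a rule replaces. -/
def lhs : Rule → Word LinkPiece
  | zig => [(1, .cup), (0, .cap)]
  | zag => [(0, .cup), (1, .cap)]
  | circle => [(0, .cup), (0, .cap)]
  | cupKink s => [(0, .cup), (0, .cross s)]
  | capKink s => [(0, .cross s), (0, .cap)]
  | cupLeft s => [(1, .cup), (0, .cross s)]
  | cupRight s => [(0, .cup), (1, .cross s)]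
  | capLeft s => [(0, .cross s), (1, .cap)]
  | capRight s => [(1, .cross s), (0, .cap)]
  | two s => [(0, .cross s), (0, .cross (!s))]
  | three s t u => [(0, .cross s), (1, .cross t), (0, .cross u)]
  | three' s t u => [(1, .cross s), (0, .cross t), (1, .cross u)]

/-- The word that a rule produces.  The third Reidemeister move leaves the three crossings as they
are unless one strand lies above or below the two others. -/
def rhs : Rule → Word LinkPiece
  | zig => []
  | zag => []
  | circle => []
  | cupKink _ => [(0, .cup)]
  | capKink _ => [(0, .cap)]
  | cupLeft s => [(0, .cup), (1, .cross (!s))]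
  | cupRight s => [(1, .cup), (0, .cross (!s))]
  | capLeft s => [(1, .cross (!s)), (0, .cap)]
  | capRight s => [(0, .cross (!s)), (1, .cap)]
  | two _ => []
  | three s t u => if s = t ∨ t = u then [(1, .cross u), (0, .cross t), (1, .cross s)]
      else [(0, .cross s), (1, .cross t), (0, .cross u)]
  | three' s t u => if s = t ∨ t = u then [(0, .cross u), (1, .cross t), (0, .cross s)]
      else [(1, .cross s), (0, .cross t), (1, .cross u)]

theorem replaceable (ρ : Rule) : Replaceable CircleMove ρ.lhs ρ.rhs := by
  cases ρ with
  | zig => exact LinkMove.zigzagRight.replaceable.circleMove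
  | zag => exact LinkMove.zigzagLeft.replaceable.circleMove
  | circle =>
    refine ⟨0, 0, fun p k h => by simp [lhs, Word.Fits, src, tgt] at h; omega,
      by simp [lhs, linkTyped_cons_iff, linkTyped_nil_iff, src, tgt], ?_⟩
    refine .of_step (by simp [lhs, linkTyped_cons_iff, linkTyped_nil_iff, src, tgt])
      (.nil 0) ?_
    simpa [lhs, rhs] using Word.Step.move [] [] 0 CircleMove.circle
  | cupKink s => exact (replaceable_cupKink s).circleMove
  | capKink s => exact (replaceable_capKink s).circleMove
  | cupLeft s => exact (replaceable_cupLeft s).circleMove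
  | cupRight s => exact (replaceable_cupRight s).circleMove
  | capLeft s => exact (replaceable_capLeft s).circleMove
  | capRight s => exact (replaceable_capRight s).circleMove
  | two s => exact (LinkMove.rII s).replaceable.circleMove
  | three s t u =>
    by_cases h : s = t ∨ t = u
    · simpa [lhs, rhs, h] using (LinkMove.rIII s t u h).replaceable.circleMove
    · rw [rhs, if_neg h]
      exact ⟨3, 3, fun p k h => by simp [lhs, Word.Fits, src, tgt] at h; omega,
        by simp [lhs, linkTyped_cons_iff, linkTyped_nil_iff, src, tgt], .refl _⟩
  | three' s t u =>
    refine ⟨3, 3, fun p k h => by simp [lhs, Word.Fits, src, tgt] at h; omega,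
      by simp [lhs, linkTyped_cons_iff, linkTyped_nil_iff, src, tgt], ?_⟩
    by_cases h : s = t ∨ t = u
    · simp only [lhs, rhs, if_pos h]
      refine (Isotopic.of_step (by simp [linkTyped_cons_iff, linkTyped_nil_iff, src, tgt])
        (by simp [linkTyped_cons_iff, linkTyped_nil_iff, src, tgt]) ?_).symm
      simpa using Word.Step.move [] [] 0 (CircleMove.move (LinkMove.rIII u t s (by tauto)))
    · rw [rhs, if_neg h]
      exact .refl _

end Rule

/-- Apply rules to a word one after the other, each at the given slice. -/
def simplify (c : List (ℕ × Rule)) (w : Word LinkPiece) : Option (Word LinkPiece) :=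
  c.foldlM (fun w a => rewriteAt a.2.lhs a.2.rhs a.1 w) w

theorem simplify_sound {c : List (ℕ × Rule)} {w w' : Word LinkPiece} {m n : ℕ}
    (h : simplify c w = some w') (hw : LinkTyped m w n) : Isotopic CircleMove m n w w' := by
  induction c generalizing w with
  | nil =>
    simp only [simplify, List.foldlM_nil, Option.pure_def, Option.some.injEq] at h
    exact .of_eq h
  | cons a c ih =>
    simp only [simplify, List.foldlM_cons, Option.bind_eq_bind, Option.bind_eq_some_iff] at h
    obtain ⟨v, hv, h⟩ := h
    have h₁ := rewriteAt_sound hv a.2.replaceable hw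
    exact h₁.trans (ih h (h₁.typed_iff.1 hw))

/-- Check that a word is a diagram with `m` strands at the bottom and `n` strands at the top. -/
def typedb : ℕ → Word LinkPiece → ℕ → Bool
  | m, [], n => m = n
  | m, (i, p) :: w, n => i + src p ≤ m && typedb (m - src p + tgt p) w n

theorem typedb_iff {m n : ℕ} {w : Word LinkPiece} : typedb m w n = true ↔ LinkTyped m w n := by
  induction w generalizing m with
  | nil => simp [typedb, linkTyped_nil_iff]
  | cons x w ih =>
    obtain ⟨i, p⟩ := x
    simp [typedb, linkTyped_cons_iff, ih]

/-- Check that two words with `m` strands at the bottom and `n` strands at the top are taken by the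
rules `c` and `c'` to words that differ only by exchanges of heights.  The rules of `c`
and those of `c'` in the opposite direction make up an isotopy of the two words, up to circles. -/
def agree (m n : ℕ) (c c' : List (ℕ × Rule)) (w w' : Word LinkPiece) : Bool :=
  typedb m w n && typedb m w' n &&
    match simplify c w, simplify c' w' with
    | some v, some v' => farEqb v v'
    | _, _ => false

theorem agree_sound {m n : ℕ} {c c' : List (ℕ × Rule)} {w w' : Word LinkPiece}
    (h : agree m n c c' w w' = true) : LinkTyped m w n ∧ Isotopic CircleMove m n w w' := by
  simp only [agree, Bool.and_eq_true, typedb_iff] at h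
  obtain ⟨⟨hw, hw'⟩, h⟩ := h
  refine ⟨hw, ?_⟩
  split at h
  · rename_i v v' hv hv'
    have h₁ := simplify_sound hv hw
    exact h₁.trans (((farEqb_sound h).isotopic (h₁.typed_iff.1 hw)).trans
      (simplify_sound hv' hw').symm)
  · simp at h

/-! ### The moves of framed graphs on the level of the three lines -/

theorem agree_zigzagRight : ∀ c : Bool, agree 3 3
    [(0, .zig), (0, .zig), (0, .zig)]
    []
    (threeLineWord [(1, .cup c), (0, .cap c)])
    (threeLineWord []) = true := by
  decide +kernel

theorem agree_zigzagLeft : ∀ c : Bool, agree 3 3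
    [(0, .zag), (0, .zag), (0, .zag)]
    []
    (threeLineWord [(0, .cup c), (1, .cap c)])
    (threeLineWord []) = true := by
  decide +kernel

theorem agree_rotateCrossLeft : ∀ s c d : Bool, agree 6 6
    [(0, .cupRight s), (0, .cupRight s), (0, .cupRight s), (0, .zag), (3, .cupRight s),
     (3, .cupRight s), (3, .cupRight s), (3, .zag), (6, .cupRight s), (6, .cupRight s),
     (6, .cupRight s), (6, .zag)]
    []
    (threeLineWord [(0, .cup d), (1, .cross s d c), (2, .cap d)])
    (threeLineWord [(0, .cross (!s) c d)]) = true := by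
  decide +kernel

theorem agree_rotateCrossRight : ∀ s c d : Bool, agree 6 6
    [(0, .cupLeft s), (0, .cupLeft s), (0, .cupLeft s), (0, .zig), (3, .cupLeft s),
     (3, .cupLeft s), (3, .cupLeft s), (3, .zig), (6, .cupLeft s), (6, .cupLeft s),
     (6, .cupLeft s), (6, .zig)]
    []
    (threeLineWord [(2, .cup c), (1, .cross s d c), (0, .cap c)])
    (threeLineWord [(0, .cross (!s) c d)]) = true := by
  decide +kernel

theorem agree_rotateVertexLeft : ∀ s : Bool, agree 6 6
    [(0, .zag), (3, .zag), (0, .cupRight s), (0, .zag)]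
    []
    (threeLineWord [(0, .cup s), (1, .vertex s), (2, .cap s)])
    (threeLineWord [(0, .vertex (!s))]) = true := by
  decide +kernel

theorem agree_rotateVertexRight : ∀ s : Bool, agree 6 6
    [(0, .zig), (3, .zig), (0, .cupLeft s), (0, .zig)]
    []
    (threeLineWord [(2, .cup (!s)), (1, .vertex s), (0, .cap (!s))])
    (threeLineWord [(0, .vertex (!s))]) = true := by
  decide +kernel

theorem agree_cup_cross_zero : ∀ s : Bool, agree 0 6
    [(1, .cupLeft s)]
    [(1, .cupRight s)]
    (threeLine (.cup s) ++ [(0, .cross s)])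
    (threeLine (.cup s) ++ [(4, .cross s)]) = true := by
  decide +kernel

theorem agree_cross_cap_zero : ∀ s : Bool, agree 6 0
    [(0, .capLeft s)]
    [(0, .capRight s)]
    ((0, .cross s) :: threeLine (.cap s))
    ((4, .cross s) :: threeLine (.cap s)) = true := by
  decide +kernel

theorem agree_left_cross_zero : ∀ s v : Bool, agree 6 6
    [(0, .three v s s), (5, .three v s s)]
    [(5, .three' s s v)]
    ((0, .cross v) :: threeLine (.cross s s s))
    (threeLine (.cross s s s) ++ [(3, .cross v)]) = true := by
  decide +kernel

theorem agree_right_cross_zero : ∀ s v : Bool, agree 6 6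
    [(0, .three' v s s), (2, .three' v s s)]
    [(6, .three s s v)]
    ((3, .cross v) :: threeLine (.cross s s s))
    (threeLine (.cross s s s) ++ [(0, .cross v)]) = true := by
  decide +kernel

theorem agree_cup_cross_one : ∀ s : Bool, agree 0 6
    [(2, .cupLeft s)]
    [(2, .cupRight s)]
    (threeLine (.cup s) ++ [(1, .cross s)])
    (threeLine (.cup s) ++ [(3, .cross s)]) = true := by
  decide +kernel

theorem agree_cross_cap_one : ∀ s : Bool, agree 6 0
    [(0, .capLeft s)]
    [(0, .capRight s)]
    ((1, .cross s) :: threeLine (.cap s))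
    ((3, .cross s) :: threeLine (.cap s)) = true := by
  decide +kernel

theorem agree_left_cross_one : ∀ s v : Bool, agree 6 6
    [(0, .three v s s), (2, .three v s s)]
    [(2, .three' s s v)]
    ((1, .cross v) :: threeLine (.cross s s s))
    (threeLine (.cross s s s) ++ [(4, .cross v)]) = true := by
  decide +kernel

theorem agree_right_cross_one : ∀ s v : Bool, agree 6 6
    [(0, .three' v s s), (3, .three' v s s)]
    [(7, .three s s v)]
    ((4, .cross v) :: threeLine (.cross s s s))
    (threeLine (.cross s s s) ++ [(1, .cross v)]) = true := by
  decide +kernel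

/-- The full twist on three strands. -/
def fullTwist (s : Bool) : Word LinkPiece :=
  [(1, .cross s), (0, .cross s), (1, .cross s), (0, .cross s), (1, .cross s), (0, .cross s)]

theorem agree_fullTwist : ∀ s : Bool, agree 3 3
    [(3, .three s s s), (5, .two s), (4, .two s), (3, .two s), (0, .three' s s s), (2, .two s),
     (1, .two s), (0, .two s)]
    []
    (fullTwist s ++ fullTwist (!s))
    ([]) = true := by
  decide +kernel

/-- Removing the kink of each of the three lines of a curl leaves a full twist. -/
theorem agree_curl_true : ∀ s c : Bool, agree 3 3
    [(2, .cupLeft s), (5, .capKink (!s)), (4, .zag), (3, .three' s s s), (1, .cupLeft s),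
     (6, .capKink (!s)), (5, .zag), (1, .three' s s s), (2, .three' s s s), (4, .three' s s s),
     (3, .three' s s s), (0, .cupLeft s), (5, .capKink (!s)), (4, .zag), (1, .three' s s s)]
    []
    (threeLineWord (curl true s c))
    (fullTwist s) = true := by
  decide +kernel

theorem agree_curl_false : ∀ s c : Bool, agree 3 3
    [(2, .cupRight s), (9, .capKink (!s)), (8, .zig), (5, .three s s s), (1, .cupRight s),
     (6, .capKink (!s)), (5, .zig), (1, .three s s s), (2, .three s s s), (4, .three s s s),
     (3, .three s s s), (0, .cupRight s), (5, .capKink (!s)), (4, .zig), (1, .three s s s),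
     (0, .three s s s)]
    [(3, .three s s s)]
    (threeLineWord (curl false s c))
    (fullTwist s) = true := by
  decide +kernel

theorem agree_rII : ∀ s c d : Bool, agree 6 6
    [(8, .two s), (5, .two s), (2, .two s), (5, .two s), (3, .two s), (1, .two s), (2, .two s),
     (1, .two s), (0, .two s)]
    []
    (threeLineWord [(0, .cross s c d), (0, .cross (!s) d c)])
    (threeLineWord []) = true := by
  decide +kernel

/-- Every strand of the first cable passes every strand of the other two: the third Reidemeister move
for cables takes one move for each choice of three lines. -/
theorem agree_rIII : ∀ s t u : Bool, s = t ∨ t = u → agree 9 9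
    [(8, .three s t u), (5, .three s t u), (2, .three s t u), (5, .three s t u),
     (3, .three s t u), (1, .three s t u), (2, .three s t u), (1, .three s t u),
     (0, .three s t u), (18, .three s t u), (12, .three s t u), (6, .three s t u),
     (11, .three s t u), (8, .three s t u), (5, .three s t u), (8, .three s t u),
     (6, .three s t u), (4, .three s t u), (22, .three s t u), (17, .three s t u),
     (12, .three s t u), (17, .three s t u), (14, .three s t u), (11, .three s t u),
     (14, .three s t u), (12, .three s t u), (10, .three s t u)]
    []
    (threeLineWord [(0, .cross s true true), (1, .cross t true true), (0, .cross u true true)])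
    (threeLineWord [(1, .cross u true true), (0, .cross t true true), (1, .cross s true true)]) =
     true := by
  decide +kernel

/-- A leg moved over a vertex meets one joint of outer lines below the crossing of the middle lines and
one above it.  On either side of the move the nearer joint is pulled off by second Reidemeister moves,
and the middle lines take a third Reidemeister move for each line of the leg. -/
theorem agree_rIVLeft : ∀ s a v : Bool, agree 9 9
    [(15, .capRight s), (8, .two s), (11, .capRight s), (5, .two s), (7, .capRight s),
     (2, .two s), (5, .three s s v), (3, .three s s v)]
    [(2, .cupLeft s), (5, .two (!s)), (4, .cupLeft s), (7, .two (!s)), (6, .cupLeft s),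
     (9, .two (!s)), (1, .three' v s s)]
    (threeLineWord [(0, .cross s a v), (1, .cross s a (!v)), (0, .vertex v)])
    (threeLineWord [(1, .vertex v), (0, .cross s a (!v)), (1, .cross s a v)]) = true := by
  decide +kernel

theorem agree_rIVRight : ∀ s a v : Bool, agree 9 9
    [(11, .capLeft s), (8, .two s), (9, .capLeft s), (7, .two s), (7, .capLeft s), (6, .two s),
     (5, .three' s s v), (4, .three' s s v)]
    [(2, .cupRight s), (9, .two (!s)), (8, .cupRight s), (9, .two (!s)), (8, .cupRight s),
     (9, .two (!s)), (1, .three v s s)]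
    (threeLineWord [(1, .cross s (!v) a), (0, .cross s v a), (1, .vertex v)])
    (threeLineWord [(0, .vertex v), (1, .cross s v a), (0, .cross s (!v) a)]) = true := by
  decide +kernel

/-- The rotated vertex with its twists simplifies to the single crossing of the middle lines. -/
theorem agree_rV : ∀ s : Bool, agree 6 6
    []
    [(4, .cupKink s), (4, .cupLeft s), (3, .three' (!s) (!s) s), (6, .two (!s)),
     (1, .three' (!s) (!s) s), (6, .two (!s)), (5, .two (!s)), (2, .cupLeft s),
     (3, .three (!s) s s), (0, .two (!s)), (1, .cupRight s), (2, .two (!s)), (2, .three (!s) s s),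
     (4, .two (!s)), (1, .cupRight s), (3, .two (!s))]
    (threeLineWord [(0, .vertex s)])
    (threeLineWord [(0, .twist s (-sgn s)), (1, .twist (!s) (-sgn s)), (0, .vertex (!s)),
     (0, .cross s s (!s)), (0, .twist (!s) (2 * sgn s)), (1, .twist s (2 * sgn s))]) = true := by
  decide +kernel

/-- In the 3-line graph of the tetrahedron, the lines around the faces open up or become separate
circles, and one crossing of middle lines is left. -/
theorem agree_oneFour : ∀ s : Bool, agree 6 6
    []
    [(0, .zig), (4, .zig), (7, .zig), (21, .zig), (23, .zag), (23, .zig), (27, .zag),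
     (1, .cupRight s), (6, .zag), (7, .two (!s)), (5, .two (!s)), (0, .cupLeft s), (1, .two (!s)),
     (16, .capLeft s), (10, .two s), (7, .two s), (12, .capLeft s), (8, .two s),
     (1, .cupLeft (!s)), (0, .cupLeft s), (7, .two (!s)), (6, .circle), (5, .circle),
     (1, .cupRight (!s)), (0, .cupRight s), (4, .two (!s)), (3, .circle), (2, .circle)]
    (threeLineWord [(0, .vertex s)])
    (threeLineWord [(1, .cup (!s)), (0, .vertex s), (4, .cup s), (3, .vertex (!s)),
     (2, .twist (!s) (sgn s)), (2, .cap s), (1, .cross s s (!s)), (0, .twist (!s) (-sgn s)),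
     (3, .twist s (-sgn s)), (2, .cup s), (3, .twist s (sgn s)), (0, .vertex s), (1, .cap s),
     (1, .vertex (!s)), (2, .cap (!s))]) = true := by
  decide +kernel

/-- The three lines of the triangle simplify until only two crossings of middle lines are left, which
are those of the two vertices, and one separate circle. -/
theorem agree_twoThree : ∀ s : Bool, agree 9 9
    [(2, .zag), (4, .zig), (1, .capLeft s), (4, .cupLeft (!s))]
    [(4, .zig), (7, .cupKink (!s)), (7, .zig), (8, .cupKink s), (9, .zig), (46, .zag),
     (7, .cupLeft s), (7, .zig), (18, .cupLeft (!s)), (6, .three' s s (!s)), (20, .two s),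
     (19, .three s (!s) (!s)), (21, .two s), (17, .cupLeft (!s)), (19, .three s (!s) (!s)),
     (1, .two s), (17, .cupRight (!s)), (18, .two s), (18, .three s (!s) (!s)), (20, .two s),
     (17, .cupRight (!s)), (19, .two s), (19, .cupLeft s), (15, .three' (!s) (!s) s),
     (21, .two (!s)), (2, .three' (!s) (!s) s), (21, .two (!s)), (20, .two (!s)),
     (17, .cupRight s), (18, .three' (!s) s s), (21, .two (!s)), (9, .three' s s s),
     (24, .capRight s), (19, .two s), (8, .three' s s s), (24, .capLeft s), (17, .two s),
     (13, .cupLeft s), (17, .three (!s) s s), (19, .two (!s)), (16, .cupRight s), (18, .two (!s)),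
     (16, .capRight s), (15, .two s), (1, .capRight (!s)), (8, .capRight s), (5, .two s),
     (2, .cupLeft (!s)), (1, .cupLeft s), (5, .three (!s) s s), (7, .two (!s)),
     (4, .cupLeft (!s)), (10, .capRight s), (9, .two s), (8, .circle), (3, .cupLeft (!s)),
     (5, .capRight s), (4, .two s), (1, .capRight s), (0, .two s), (3, .capLeft s)]
    (threeLineWord [(0, .vertex s), (1, .cap s), (1, .cup s), (0, .vertex (!s))])
    (threeLineWord [(0, .twist s (2 * sgn s)), (2, .twist s (-2 * sgn s)), (1, .cup (!s)),
     (0, .vertex s), (5, .cup (!s)), (4, .vertex s), (2, .cross s (!s) (!s)), (3, .cap (!s)),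
     (0, .cross (!s) (!s) s), (3, .cross s s (!s)), (1, .twist (!s) (-3 * sgn s)),
     (3, .twist (!s) (3 * sgn s)), (1, .vertex s), (2, .cap s), (0, .twist s (-2 * sgn s)),
     (2, .twist s (2 * sgn s))]) = true := by
  decide +kernel

/-! ### Twists -/

theorem farEq_cons_interchange (i k : ℕ) (p : LinkPiece) (w : Word LinkPiece) :
    FarEq ((i, p) :: w.shift (i + tgt p + k)) (w.shift (i + src p + k) ++ [(i, p)]) := by
  induction w with
  | nil => exact .refl _
  | cons x w ih =>
    have h : FarEq [(i, p), (i + tgt p + k + x.1, x.2)] [(i + src p + k + x.1, x.2), (i, p)] := by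
      refine .rel _ _ ?_
      have := Word.Step.far (R := fun _ _ => False) [] [] p x.2 i (k + x.1)
      simpa [Nat.add_assoc] using this
    exact (h.append_right (Word.shift (i + tgt p + k) w)).trans
      (FarEq.append_left [(i + src p + k + x.1, x.2)] ih)

/-- Two words side by side may be exchanged in height. -/
theorem farEq_interchange {m n : ℕ} {u : Word LinkPiece} (hu : LinkTyped m u n) (k : ℕ)
    (w : Word LinkPiece) : FarEq (u ++ w.shift (n + k)) (w.shift (m + k) ++ u) := by
  induction hu with
  | nil n => simpa using FarEq.refl _
  | cons i j p u n _ ih =>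
    have h := farEq_cons_interchange i (j + k) p w
    rw [← Nat.add_assoc, ← Nat.add_assoc] at h
    simpa using (ih.append_left [(i, p)]).trans (h.append_right u)

theorem farEq_cross_shift (j : ℕ) (s : Bool) (hj : j < 2) (w : Word LinkPiece) :
    FarEq ((j, .cross s) :: w.shift 3) (w.shift 3 ++ [(j, .cross s)]) := by
  obtain ⟨k, hk⟩ := Nat.exists_eq_add_of_le (show j + 2 ≤ 3 by omega)
  have := farEq_cons_interchange j k (.cross s) w
  simpa [src, tgt, ← hk] using this

/-- The word consists of crossings of three strands. -/
def IsBraid (w : Word LinkPiece) : Prop := ∀ x ∈ w, ∃ j s, x = (j, LinkPiece.cross s) ∧ j < 2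

theorem IsBraid.typed {w : Word LinkPiece} (h : IsBraid w) : LinkTyped 3 w 3 :=
  linkTyped_crosses w 3 fun x hx => by
    obtain ⟨j, s, rfl, hj⟩ := h x hx
    exact ⟨s, rfl, by simp only; omega⟩

theorem isBraid_braid (c : Bool) (t : ℤ) : IsBraid (braid c t) := by
  intro x hx
  simp only [braid, List.mem_map] at hx
  obtain ⟨j, -, rfl⟩ := hx
  exact ⟨_, _, rfl, Nat.mod_lt _ two_pos⟩

/-- The braid word turned upside down. -/
def turnOver (w : Word LinkPiece) : Word LinkPiece := (w.map fun x => (1 - x.1, x.2)).reverse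

@[simp] theorem turnOver_cons (x : ℕ × LinkPiece) (w : Word LinkPiece) :
    turnOver (x :: w) = turnOver w ++ [(1 - x.1, x.2)] := by simp [turnOver]

theorem turnOver_append (v w : Word LinkPiece) : turnOver (v ++ w) = turnOver w ++ turnOver v := by
  simp [turnOver]

theorem IsBraid.turnOver {w : Word LinkPiece} (h : IsBraid w) : IsBraid (turnOver w) := by
  intro x hx
  simp only [FramedGraph.turnOver, List.mem_reverse, List.mem_map] at hx
  obtain ⟨y, hy, rfl⟩ := hx
  obtain ⟨j, s, rfl, -⟩ := h y hy
  exact ⟨_, _, rfl, by simp only; omega⟩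

theorem turnOver_braid (c : Bool) (t : ℤ) : turnOver (braid c t) = braid (turn c t) t := by
  apply List.ext_getElem
  · simp [turnOver, braid]
  intro i h₁ h₂
  have hi : i < t.natAbs := by simpa [turnOver, braid] using h₁
  simp only [turnOver, braid, List.getElem_reverse, List.getElem_map, List.getElem_range,
    List.length_map, List.length_range, Prod.mk.injEq, and_true]
  by_cases hn : Even t
  · have := Nat.even_iff.1 (Int.natAbs_even.2 hn)
    rw [show turn c t = c from if_pos hn]
    split_ifs <;> omega
  · have := Nat.odd_iff.1 (Int.natAbs_odd.2 (Int.not_even_iff_odd.1 hn))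
    rw [show turn c t = !c from if_neg hn]
    cases c <;> cases decide (0 ≤ t) <;> simp <;> omega

/-- A braid slides through a minimum from the left leg to the right one, upside down. -/
theorem isotopic_cup_braid {w : Word LinkPiece} (h : IsBraid w) (c : Bool) :
    Isotopic CircleMove 0 6 (threeLine (.cup c) ++ w)
      (threeLine (.cup c) ++ (turnOver w).shift 3) := by
  have hcup : LinkTyped 0 (threeLine (.cup c)) 6 := linkTyped_threeLine (.cup c)
  induction w using List.reverseRecOn with
  | nil => exact .refl _
  | append_singleton w x ih =>
    have hw : IsBraid w := fun y hy => h y (by simp [hy])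
    obtain ⟨j, s, rfl, hj⟩ := h x (by simp)
    have hx : LinkTyped 6 [(j, LinkPiece.cross s)] 6 :=
      linkTyped_crosses _ 6 (by simp; omega)
    have hshift : LinkTyped 6 ((turnOver w).shift 3) 6 := by
      simpa using hw.turnOver.typed.shift 3 0
    have base : Isotopic CircleMove 0 6 (threeLine (.cup c) ++ [(j, .cross s)])
        (threeLine (.cup c) ++ [(3 + (1 - j), .cross s)]) := by
      obtain rfl | rfl : j = 0 ∨ j = 1 := by omega
      · exact (agree_sound (agree_cup_cross_zero s)).2
      · exact (agree_sound (agree_cup_cross_one s)).2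
    have e₁ := (ih hw).append_right hx
    have e₂ := ((farEq_cross_shift j s hj (turnOver w)).symm.append_left
      (threeLine (.cup c))).isotopic (R := CircleMove) (m := 0) (n := 6)
        (hcup.append (hshift.append hx))
    have e₃ := base.append_right hshift
    rw [turnOver_append]
    simp only [List.append_assoc, List.cons_append, List.nil_append, Word.shift_append] at e₁ e₂ e₃ ⊢
    exact e₁.trans (e₂.trans e₃)

/-- A braid slides through a maximum from the left leg to the right one, upside down. -/
theorem isotopic_braid_cap {w : Word LinkPiece} (h : IsBraid w) (c : Bool) :
    Isotopic CircleMove 6 0 (w ++ threeLine (.cap c))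
      ((turnOver w).shift 3 ++ threeLine (.cap c)) := by
  have hcap : LinkTyped 6 (threeLine (.cap c)) 0 := linkTyped_threeLine (.cap c)
  induction w with
  | nil => exact .refl _
  | cons x w ih =>
    have hw : IsBraid w := fun y hy => h y (by simp [hy])
    obtain ⟨j, s, rfl, hj⟩ := h x (by simp)
    have hx : LinkTyped 6 [(j, LinkPiece.cross s)] 6 :=
      linkTyped_crosses _ 6 (by simp; omega)
    have hshift : LinkTyped 6 ((turnOver w).shift 3) 6 := by
      simpa using hw.turnOver.typed.shift 3 0
    have base : Isotopic CircleMove 6 0 ((j, .cross s) :: threeLine (.cap c))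
        ((3 + (1 - j), .cross s) :: threeLine (.cap c)) := by
      obtain rfl | rfl : j = 0 ∨ j = 1 := by omega
      · exact (agree_sound (agree_cross_cap_zero s)).2
      · exact (agree_sound (agree_cross_cap_one s)).2
    have e₁ := (ih hw).append_left hx
    have e₂ := ((farEq_cross_shift j s hj (turnOver w)).append_right
      (threeLine (.cap c))).isotopic (R := CircleMove) (m := 6) (n := 0)
        ((hx.append hshift).append hcap)
    have e₃ := base.append_left hshift
    simp only [turnOver_cons, List.append_assoc, List.cons_append, List.nil_append,
      Word.shift_append] at e₁ e₂ e₃ ⊢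
    exact e₁.trans (e₂.trans e₃)

theorem isotopic_braid_cross_left {w : Word LinkPiece} (h : IsBraid w) (s c d c' d' : Bool) :
    Isotopic CircleMove 6 6 (w ++ threeLine (.cross s c d))
      (threeLine (.cross s c' d') ++ w.shift 3) := by
  induction w with
  | nil => exact .of_eq (by simp [threeLine])
  | cons x w ih =>
    have hw : IsBraid w := fun y hy => h y (by simp [hy])
    obtain ⟨j, r, rfl, hj⟩ := h x (by simp)
    have hx : LinkTyped 6 [(j, LinkPiece.cross r)] 6 :=
      linkTyped_crosses _ 6 (by simp; omega)
    have hshift : LinkTyped 6 (Word.shift 3 w) 6 := by simpa using hw.typed.shift 3 0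
    have base : Isotopic CircleMove 6 6 ((j, .cross r) :: threeLine (.cross s c' d'))
        (threeLine (.cross s c' d') ++ [(3 + j, .cross r)]) := by
      obtain rfl | rfl : j = 0 ∨ j = 1 := by omega
      · exact (agree_sound (agree_left_cross_zero s r)).2
      · exact (agree_sound (agree_left_cross_one s r)).2
    have e₁ := (ih hw).append_left hx
    have e₂ := base.append_right hshift
    simp only [List.append_assoc, List.cons_append, List.nil_append, Word.shift_cons] at e₁ e₂ ⊢
    exact e₁.trans e₂

theorem isotopic_braid_cross_right {w : Word LinkPiece} (h : IsBraid w) (s c d c' d' : Bool) :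
    Isotopic CircleMove 6 6 (w.shift 3 ++ threeLine (.cross s c d))
      (threeLine (.cross s c' d') ++ w) := by
  induction w with
  | nil => exact .of_eq (by simp [threeLine])
  | cons x w ih =>
    have hw : IsBraid w := fun y hy => h y (by simp [hy])
    obtain ⟨j, r, rfl, hj⟩ := h x (by simp)
    have hx : LinkTyped 6 [(3 + j, LinkPiece.cross r)] 6 :=
      linkTyped_crosses _ 6 (by simp; omega)
    have hw' : LinkTyped 6 w 6 := by simpa using hw.typed.shift 0 3
    have base : Isotopic CircleMove 6 6 ((3 + j, .cross r) :: threeLine (.cross s c' d'))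
        (threeLine (.cross s c' d') ++ [(j, .cross r)]) := by
      obtain rfl | rfl : j = 0 ∨ j = 1 := by omega
      · exact (agree_sound (agree_right_cross_zero s r)).2
      · exact (agree_sound (agree_right_cross_one s r)).2
    have e₁ := (ih hw).append_left hx
    have e₂ := base.append_right hw'
    simp only [List.append_assoc, List.cons_append, List.nil_append, Word.shift_cons] at e₁ e₂ ⊢
    exact e₁.trans e₂

theorem turn_turn (c : Bool) (t u : ℤ) : turn (turn c t) u = turn c (t + u) := by
  by_cases ht : Even t <;> by_cases hu : Even u <;> simp [turn, ht, hu, Int.even_add]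

theorem braid_add_one (c : Bool) {t : ℤ} (ht : 0 ≤ t) :
    braid c (t + 1) = braid c t ++ braid (turn c t) 1 := by
  obtain ⟨n, rfl⟩ := Int.eq_ofNat_of_zero_le ht
  have h₁ : (0 : ℤ) ≤ (n : ℤ) + 1 := by omega
  have h₂ : ((n : ℤ) + 1).natAbs = n + 1 := by omega
  simp only [braid, ht, h₁, h₂, Int.natAbs_natCast, List.range_succ, List.map_append,
    Int.natAbs_one, turn, Int.even_coe_nat]
  by_cases hn : Even n
  · have := Nat.even_iff.1 hn
    cases c <;> simp [hn] <;> omega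
  · have := Nat.odd_iff.1 (Nat.not_even_iff_odd.1 hn)
    cases c <;> simp [hn] <;> omega

theorem braid_sub_one (c : Bool) {t : ℤ} (ht : t ≤ 0) :
    braid c (t - 1) = braid c t ++ braid (turn c t) (-1) := by
  obtain ⟨n, rfl⟩ : ∃ n : ℕ, t = -n := ⟨t.natAbs, by omega⟩
  obtain rfl | hpos := Nat.eq_zero_or_pos n
  · simp [braid, turn]
  have h₁ : ¬ (0 : ℤ) ≤ -(n : ℤ) - 1 := by omega
  have h₂ : (-(n : ℤ) - 1).natAbs = n + 1 := by omega
  have h₃ : ¬ (0 : ℤ) ≤ -(n : ℤ) := by omega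
  simp only [braid, h₃, h₁, h₂, Int.natAbs_neg, Int.natAbs_natCast, List.range_succ,
    List.map_append, Int.natAbs_one, turn, even_neg, Int.even_coe_nat]
  by_cases hn : Even n
  · have := Nat.even_iff.1 hn
    cases c <;> simp [hn] <;> omega
  · have := Nat.odd_iff.1 (Nat.not_even_iff_odd.1 hn)
    cases c <;> simp [hn] <;> omega

theorem agree_twist_cancel : ∀ c : Bool,
    agree 3 3 [(0, .two true)] [] (braid c 1 ++ braid (turn c 1) (-1)) [] = true := by
  decide +kernel

theorem agree_twist_cancel' : ∀ c : Bool,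
    agree 3 3 [(0, .two false)] [] (braid c (-1) ++ braid (turn c (-1)) 1) [] = true := by
  decide +kernel

theorem isotopic_braid_add_one (c : Bool) (t : ℤ) :
    Isotopic CircleMove 3 3 (braid c t ++ braid (turn c t) 1) (braid c (t + 1)) := by
  obtain ht | ht := le_or_gt 0 t
  · exact .of_eq (braid_add_one c ht).symm
  · have h := (agree_sound (agree_twist_cancel' (turn c (t + 1)))).2
    have e := braid_sub_one c (t := t + 1) (by omega)
    rw [turn_turn, add_neg_cancel_right] at h
    rw [add_sub_cancel_right] at e
    rw [e, List.append_assoc]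
    simpa using h.append_left (isBraid_braid c (t + 1)).typed

theorem isotopic_braid_sub_one (c : Bool) (t : ℤ) :
    Isotopic CircleMove 3 3 (braid c t ++ braid (turn c t) (-1)) (braid c (t - 1)) := by
  obtain ht | ht := le_or_gt t 0
  · exact .of_eq (braid_sub_one c ht).symm
  · have h := (agree_sound (agree_twist_cancel (turn c (t - 1)))).2
    have e := braid_add_one c (t := t - 1) (by omega)
    rw [turn_turn, sub_add_cancel] at h
    rw [sub_add_cancel] at e
    rw [e, List.append_assoc]
    simpa using h.append_left (isBraid_braid c (t - 1)).typed

/-- Successive twists add up.  Adding a unit either prolongs the alternating braid word or cancels its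
last crossing, by the choice of the first place in `braid`. -/
theorem isotopic_braid_add (c : Bool) (t u : ℤ) :
    Isotopic CircleMove 3 3 (braid c t ++ braid (turn c t) u) (braid c (t + u)) := by
  have key : ∀ u ε : ℤ, (∀ c t, Isotopic CircleMove 3 3 (braid c t ++ braid (turn c t) ε)
        (braid c (t + ε))) →
      Isotopic CircleMove 3 3 (braid c t ++ braid (turn c t) u) (braid c (t + u)) →
      Isotopic CircleMove 3 3 (braid c t ++ braid (turn c t) (u + ε)) (braid c (t + (u + ε))) := by
    intro u ε hε hu
    have e₁ := (hε (turn c t) u).append_left (isBraid_braid c t).typed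
    have e₂ := hu.append_right (isBraid_braid (turn c (t + u)) ε).typed
    have e₃ := hε c (t + u)
    rw [turn_turn, ← List.append_assoc] at e₁
    rw [← add_assoc]
    exact e₁.symm.trans (e₂.trans e₃)
  induction u using Int.induction_on with
  | zero => exact .of_eq (by simp [braid])
  | succ u ih => exact key u 1 isotopic_braid_add_one ih
  | pred u ih =>
    exact key (-u) (-1) (fun c t => by simpa [sub_eq_add_neg] using isotopic_braid_sub_one c t) ih

/-! ### Invariance of the 3-line graph up to separate circles -/

theorem threeLineWord_append (u v : Word GraphPiece) :
    threeLineWord (u ++ v) = threeLineWord u ++ threeLineWord v := List.flatMap_append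

theorem threeLineWord_cons (x : ℕ × GraphPiece) (w : Word GraphPiece) :
    threeLineWord (x :: w) = (threeLine x.2).shift (3 * x.1) ++ threeLineWord w := rfl

theorem threeLineWord_shift (k : ℕ) (w : Word GraphPiece) :
    threeLineWord (w.shift k) = (threeLineWord w).shift (3 * k) := by
  induction w with
  | nil => rfl
  | cons x w ih =>
    simp [threeLineWord_cons, ih, Word.shift_shift, Nat.mul_add]

theorem GraphTyped.cons_inv {S T : List Bool} {x : ℕ × GraphPiece} {w : Word GraphPiece}
    (h : GraphTyped S (x :: w) T) :
    x.1 + src x.2 ≤ S.length ∧ ∃ S', S'.length = S.length - src x.2 + tgt x.2 ∧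
      GraphTyped S [x] S' ∧ GraphTyped S' w T := by
  cases h with
  | cons a b p w T h =>
    refine ⟨by simp [src], a ++ p.cod ++ b, by simp [src, tgt]; omega,
      .cons a b p [] _ (.nil _), h⟩

theorem GraphTyped.append {S T U : List Bool} {u v : Word GraphPiece} (h : GraphTyped S u T)
    (h' : GraphTyped T v U) : GraphTyped S (u ++ v) U := by
  induction h with
  | nil S => exact h'
  | cons a b p w T _ ih => exact .cons a b p _ _ (ih h')

theorem GraphTyped.append_inv {S T : List Bool} {u v : Word GraphPiece}
    (h : GraphTyped S (u ++ v) T) : ∃ U, GraphTyped S u U ∧ GraphTyped U v T := by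
  induction u generalizing S with
  | nil => exact ⟨S, .nil S, h⟩
  | cons x u ih =>
    obtain ⟨-, S', -, h₁, h₂⟩ := h.cons_inv
    obtain ⟨U, h₃, h₄⟩ := ih h₂
    exact ⟨U, by simpa using h₁.append h₃, h₄⟩

theorem GraphTyped.fits {S T : List Bool} {w : Word GraphPiece} (h : GraphTyped S w T) :
    Word.Fits S.length w := by
  induction w generalizing S with
  | nil => trivial
  | cons x w ih =>
    obtain ⟨h₁, S', h₂, -, h₃⟩ := h.cons_inv
    exact ⟨h₁, h₂ ▸ ih h₃⟩

/-- The graph words `l` and `r` have 3-line graphs that agree up to isotopy and separate circles,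
on the least number `m` of edges on which `l` makes sense. -/
def ThreeLineEquiv (l r : Word GraphPiece) : Prop :=
  ∃ m n, (∀ p k, Word.Fits p (l.shift k) → k + m ≤ p) ∧
    LinkTyped (3 * m) (threeLineWord l) (3 * n) ∧
    Isotopic CircleMove (3 * m) (3 * n) (threeLineWord l) (threeLineWord r)

section LocalMoves

attribute [local simp] Word.Fits src tgt GraphPiece.dom GraphPiece.cod

theorem GraphIsotopy.threeLineEquiv {l r : Word GraphPiece} (h : GraphIsotopy l r) :
    ThreeLineEquiv l r := by
  cases h with
  | zigzagRight c => exact ⟨1, 1, fun p k h => by simp at h; omega,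
      agree_sound (agree_zigzagRight c)⟩
  | zigzagLeft c => exact ⟨1, 1, fun p k h => by simp at h; omega, agree_sound (agree_zigzagLeft c)⟩
  | rotateCrossLeft s c d => exact ⟨2, 2, fun p k h => by simp at h; omega,
      agree_sound (agree_rotateCrossLeft s c d)⟩
  | rotateCrossRight s c d => exact ⟨2, 2, fun p k h => by simp at h; omega,
      agree_sound (agree_rotateCrossRight s c d)⟩
  | rotateVertexLeft s => exact ⟨2, 2, fun p k h => by simp at h; omega,
      agree_sound (agree_rotateVertexLeft s)⟩
  | rotateVertexRight s => exact ⟨2, 2, fun p k h => by simp at h; omega,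
      agree_sound (agree_rotateVertexRight s)⟩
  | twistZero c =>
    refine ⟨1, 1, fun p k h => by simp at h; omega, ?_, .refl _⟩
    exact .nil 3
  | twistAdd c t u =>
    refine ⟨1, 1, fun p k h => by simp at h; omega, ?_, ?_⟩
    · simpa [threeLineWord, threeLine] using
        (isBraid_braid c t).typed.append (isBraid_braid (turn c t) u).typed
    · simpa [threeLineWord, threeLine] using isotopic_braid_add c t u
  | twistCup c t =>
    refine ⟨0, 2, fun p k h => by simp at h; omega, ?_, ?_⟩
    · simpa [threeLineWord, threeLine] using
        (linkTyped_threeLine (.cup c)).append ((isBraid_braid c t).typed.shift 0 3)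
    · simpa [threeLineWord, threeLine, turnOver_braid] using
        isotopic_cup_braid (isBraid_braid c t) c
  | twistCap c t =>
    refine ⟨2, 0, fun p k h => by simp at h; omega, ?_, ?_⟩
    · simpa [threeLineWord, threeLine] using
        ((isBraid_braid c t).typed.shift 0 3).append (linkTyped_threeLine (.cap c))
    · simpa [threeLineWord, threeLine, turnOver_braid] using
        isotopic_braid_cap (isBraid_braid c t) c
  | twistCrossLeft s c d t =>
    refine ⟨2, 2, fun p k h => by simp at h; omega, ?_, ?_⟩
    · simpa [threeLineWord, threeLine] using
        ((isBraid_braid c t).typed.shift 0 3).append (linkTyped_threeLine (.cross s c d))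
    · simpa [threeLineWord, threeLine] using
        isotopic_braid_cross_left (isBraid_braid c t) s c d c d
  | twistCrossRight s c d t =>
    refine ⟨2, 2, fun p k h => by simp at h; omega, ?_, ?_⟩
    · simpa [threeLineWord, threeLine] using
        ((isBraid_braid d t).typed.shift 3 0).append (linkTyped_threeLine (.cross s c d))
    · simpa [threeLineWord, threeLine] using
        isotopic_braid_cross_right (isBraid_braid d t) s c d c d

/-- Every curl in a leg is a full twist of its three lines, right-handed or left-handed as the
crossing of the curl. -/
theorem isotopic_curl (k s c : Bool) :
    LinkTyped 3 (threeLineWord (curl k s c)) 3 ∧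
      Isotopic CircleMove 3 3 (threeLineWord (curl k s c)) (fullTwist s) := by
  cases k
  · exact agree_sound (agree_curl_false s c)
  · exact agree_sound (agree_curl_true s c)

theorem GraphReidemeister.threeLineEquiv {l r : Word GraphPiece} (h : GraphReidemeister l r) :
    ThreeLineEquiv l r := by
  cases h with
  | rI k k' s c =>
    obtain ⟨h₁, e₁⟩ := isotopic_curl k s c
    obtain ⟨h₂, e₂⟩ := isotopic_curl k' (!s) c
    refine ⟨1, 1, fun p k₀ h => ?_, ?_, ?_⟩
    · rw [Word.shift_append] at h
      have h := h.of_append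
      cases k <;> simp [curl] at h <;> omega
    · rw [threeLineWord_append]
      exact h₁.append h₂
    · rw [threeLineWord_append]
      exact (e₂.append_left h₁).trans
        ((e₁.append_right (e₂.typed_iff.1 h₂)).trans (agree_sound (agree_fullTwist s)).2)
  | rII s c d => exact ⟨2, 2, fun p k h => by simp at h; omega, agree_sound (agree_rII s c d)⟩
  | rIII s t u a b c hstu => exact ⟨3, 3, fun p k h => by simp at h; omega,
      agree_sound (agree_rIII s t u hstu)⟩
  | rIVLeft s a v => exact ⟨3, 3, fun p k h => by simp at h; omega,
      agree_sound (agree_rIVLeft s a v)⟩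
  | rIVRight s a v => exact ⟨3, 3, fun p k h => by simp at h; omega,
      agree_sound (agree_rIVRight s a v)⟩
  | rV s => exact ⟨2, 2, fun p k h => by simp at h; omega, agree_sound (agree_rV s)⟩

theorem GraphPachner.threeLineEquiv {l r : Word GraphPiece} (h : GraphPachner l r) :
    ThreeLineEquiv l r := by
  cases h with
  | oneFour s => exact ⟨2, 2, fun p k h => by simp at h; omega, agree_sound (agree_oneFour s)⟩
  | twoThree s => exact ⟨3, 3, fun p k h => by simp at h; omega, agree_sound (agree_twoThree s)⟩

end LocalMoves

theorem GraphMove.threeLineEquiv {l r : Word GraphPiece} (h : GraphMove l r) :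
    ThreeLineEquiv l r := by
  cases h with
  | isotopy h => exact h.threeLineEquiv
  | reidemeister h => exact h.threeLineEquiv
  | pachner h => exact h.threeLineEquiv

/-- A move of graph diagrams changes the 3-line graph by an isotopy and separate circles. -/
theorem isotopic_threeLineWord {w w' : Word GraphPiece} (h : Word.Step GraphMove w w')
    (hw : GraphTyped [] w []) :
    Isotopic CircleMove 0 0 (threeLineWord w) (threeLineWord w') := by
  cases h with
  | move u v k h =>
    obtain ⟨m, n, hf, hl, hlr⟩ := h.threeLineEquiv
    obtain ⟨T, hul, hv⟩ := hw.append_inv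
    obtain ⟨S, hu, hlk⟩ := hul.append_inv
    obtain ⟨b, hb⟩ := Nat.exists_eq_add_of_le (hf _ _ hlk.fits)
    have hu' := linkTyped_threeLineWord hu
    have hv' := linkTyped_threeLineWord hv
    have hlk' := linkTyped_threeLineWord hlk
    simp only [threeLineWord_append, threeLineWord_shift] at hlk' ⊢
    rw [hb, show 3 * (k + m + b) = 3 * k + 3 * m + 3 * b by ring] at hlk' hu'
    rw [hlk'.unique (hl.shift (3 * k) (3 * b))] at hv'
    exact .append_right (.append_left hu' (hlr.shift (3 * k) (3 * b))) hv'
  | far u v p q i k =>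
    have h₁ := farEq_interchange (linkTyped_threeLine p) (3 * k) (threeLine q)
    have h₂ : FarEq ((threeLine p).shift (3 * i) ++ (threeLine q).shift (3 * (i + tgt p + k)))
        ((threeLine q).shift (3 * (i + src p + k)) ++ (threeLine p).shift (3 * i)) := by
      have : FarEq _ _ := eqvGen_map (Word.shift (3 * i)) (fun _ _ h => h.shift (3 * i)) h₁
      simpa [Word.shift_shift, Nat.mul_add, Nat.add_assoc, src, tgt] using this
    have h₃ := h₂.context (threeLineWord u) (threeLineWord v)
    have hw' := linkTyped_threeLineWord hw
    simp only [threeLineWord_append, threeLineWord_cons] at hw' ⊢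
    exact FarEq.isotopic (by simpa [threeLineWord] using h₃) hw'

/-! ### Separate circles -/

/-- A row of `n` separate circles. -/
def circles (n : ℕ) : Word LinkPiece := (List.replicate n [(0, .cup), (0, .cap)]).flatten

theorem circles_add (m n : ℕ) : circles (m + n) = circles m ++ circles n := by
  rw [circles, List.replicate_add, List.flatten_append]; rfl

theorem linkTyped_circle : LinkTyped 0 [(0, .cup), (0, .cap)] 0 :=
  .cons 0 0 .cup _ _ (.cons 0 0 .cap _ _ (.nil 0))

theorem linkTyped_circles (n : ℕ) : LinkTyped 0 (circles n) 0 := by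
  induction n with
  | zero => exact .nil 0
  | succ n ih =>
    rw [circles_add]
    exact ih.append (by simpa [circles] using linkTyped_circle)

theorem LinkDiagram.addCircle_iterate (M : LinkDiagram) (n : ℕ) :
    (LinkDiagram.addCircle^[n] M).1 = M.1 ++ circles n := by
  induction n with
  | zero => simp [circles]
  | succ n ih =>
    have h : (LinkDiagram.addCircle^[n] M).addCircle.1
        = (LinkDiagram.addCircle^[n] M).1 ++ circles 1 := rfl
    rw [Function.iterate_succ_apply', h, ih, circles_add, List.append_assoc]

/-- A circle passes under a strand: it is first linked with the strand by a second Reidemeister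
move, and then drawn to the other side. -/
theorem isotopic_circle_pass : Isotopic LinkMove 1 1
    [(1, .cup), (1, .cap)] [(0, .cup), (0, .cap)] := by
  have hw : LinkTyped 1 [(1, .cup), (0, .cross false), (0, .cross true), (1, .cap)] 1 :=
    typedb_iff.1 rfl
  have h₁ := rewriteAt_sound (w' := [(1, .cup), (1, .cap)]) (j := 1) rfl
    (LinkMove.rII false).replaceable hw
  have h₂ := rewriteAt_sound
    (w' := [(0, .cup), (1, .cross true), (0, .cross true), (1, .cap)]) (j := 0) rfl
    (replaceable_cupLeft false) hw
  have h₃ := rewriteAt_sound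
    (w' := [(0, .cup), (1, .cross true), (1, .cross false), (0, .cap)]) (j := 2) rfl
    (replaceable_capLeft true) (h₂.typed_iff.1 hw)
  have h₄ := rewriteAt_sound (w' := [(0, .cup), (0, .cap)]) (j := 1) rfl
    (LinkMove.rII true).replaceable ((h₂.trans h₃).typed_iff.1 hw)
  exact h₁.symm.trans (h₂.trans (h₃.trans h₄))

theorem isotopic_circle_shift {k m : ℕ} (h : k ≤ m) : Isotopic LinkMove m m
    [(k, .cup), (k, .cap)] [(0, .cup), (0, .cap)] := by
  obtain ⟨b, rfl⟩ := Nat.exists_eq_add_of_le h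
  induction k generalizing b with
  | zero => exact .refl _
  | succ k ih =>
    have h₁ := isotopic_circle_pass.shift k b
    have h₂ := ih (1 + b) (by omega)
    rw [← Nat.add_assoc] at h₂
    exact h₁.trans h₂

/-- A circle in the middle of a diagram is moved to the end. -/
theorem isotopic_circle_last {k : ℕ} {u v : Word LinkPiece}
    (h : LinkTyped 0 (u ++ [(k, .cup), (k, .cap)] ++ v) 0) :
    Isotopic LinkMove 0 0 (u ++ [(k, .cup), (k, .cap)] ++ v) (u ++ v ++ circles 1) := by
  obtain ⟨q, hul, hv⟩ := linkTyped_append_iff.1 h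
  obtain ⟨p, hu, hl⟩ := linkTyped_append_iff.1 hul
  have hl' := hl
  simp only [linkTyped_cons_iff, linkTyped_nil_iff, src, tgt] at hl'
  obtain rfl : p = q := by omega
  have h₁ := ((isotopic_circle_shift (show k ≤ p by omega)).append_left hu).append_right hv
  have h₂ := (farEq_interchange linkTyped_circle 0 v).append_left u
  simp only [Nat.zero_add, Word.shift_zero, ← List.append_assoc] at h₂
  exact h₁.trans (h₂.isotopic (h₁.typed_iff.1 h))

/-- Circles created or removed in the course of an isotopy can all be collected at the end. -/
theorem Isotopic.exists_circles {w w' : Word LinkPiece} (h : Isotopic CircleMove 0 0 w w') :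
    ∃ a b, Isotopic LinkMove 0 0 (w ++ circles a) (w' ++ circles b) := by
  induction h with
  | rel x y h =>
    obtain ⟨hx, hy, h⟩ := h
    cases h with
    | move u v k h =>
      cases h with
      | move h =>
        exact ⟨0, 0, by simpa [circles] using Isotopic.of_step hx hy (.move u v k h)⟩
      | circle => exact ⟨0, 1, by simpa [circles] using isotopic_circle_last hx⟩
    | far u v p q i k =>
      exact ⟨0, 0, by simpa [circles] using Isotopic.of_step hx hy (.far u v p q i k)⟩
  | refl x => exact ⟨0, 0, .refl _⟩
  | symm x y _ ih =>
    obtain ⟨a, b, h⟩ := ih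
    exact ⟨b, a, h.symm⟩
  | trans x y z _ _ ih₁ ih₂ =>
    obtain ⟨a, b, h₁⟩ := ih₁
    obtain ⟨c, d, h₂⟩ := ih₂
    have e₁ := h₁.append_right (linkTyped_circles c)
    have e₂ := h₂.append_right (linkTyped_circles b)
    rw [List.append_assoc, List.append_assoc, ← circles_add, ← circles_add] at e₁ e₂
    rw [Nat.add_comm c b] at e₂
    exact ⟨a + c, d + b, e₁.trans e₂⟩

/-! ### Two-colourings of link diagrams and their sublinks -/

/-- The colourings of the elementary piece `p` over `i` further strands, if the colours of the
strands below it are `S`.  The two strands of a minimum may have either colour, the two strands of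
a maximum must have the same one, and the colours follow the strands through a crossing.  A
colouring is given by the colours of the strands above the piece, and for each of the two colours
`e` by the word that remains of the piece when all strands of the other colour are deleted. -/
def pieceColourings (S : List Bool) (i : ℕ) :
    LinkPiece → Multiset (List Bool × (Bool → Word LinkPiece))
  | .cup => ({true, false} : Multiset Bool).map fun c =>
      (S.take i ++ c :: c :: S.drop i, fun e => if c = e then [((S.take i).count e, .cup)] else [])
  | .cap =>
    match S.drop i with
    | x :: y :: b =>
      if x = y then
        {(S.take i ++ b, fun e => if x = e then [((S.take i).count e, .cap)] else [])}
      else 0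
    | _ => 0
  | .cross s =>
    match S.drop i with
    | x :: y :: b =>
      {(S.take i ++ y :: x :: b,
        fun e => if x = e ∧ y = e then [((S.take i).count e, .cross s)] else [])}
    | _ => 0

/-- The colourings of a word by two colours, constant along every strand, if the colours of the
strands at the bottom are `S`.  A colouring is given by the colours of the strands at the top and by
the two words that are left when the strands of one colour are deleted. -/
def colourings (S : List Bool) :
    Word LinkPiece → Multiset (List Bool × (Bool → Word LinkPiece))
  | [] => {(S, fun _ => [])}
  | (i, p) :: w => (pieceColourings S i p).bind fun x =>
      (colourings x.1 w).map fun y => (y.1, fun e => x.2 e ++ y.2 e)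

theorem colourings_append (S : List Bool) (u v : Word LinkPiece) :
    colourings S (u ++ v) = (colourings S u).bind fun x =>
      (colourings x.1 v).map fun y => (y.1, fun e => x.2 e ++ y.2 e) := by
  induction u generalizing S with
  | nil => simp [colourings]
  | cons a u ih =>
    obtain ⟨i, p⟩ := a
    simp only [colourings, List.cons_append, ih, Multiset.bind_assoc, Multiset.bind_map,
      Multiset.map_bind, Multiset.map_map, Function.comp_def, List.append_assoc]

theorem pieceColourings_typed {S : List Bool} {i : ℕ} {p : LinkPiece}
    {x : List Bool × (Bool → Word LinkPiece)} (hx : x ∈ pieceColourings S i p) (e : Bool) :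
    LinkTyped (S.count e) (x.2 e) (x.1.count e) := by
  have hS : S.count e = (S.take i).count e + (S.drop i).count e := by
    rw [← List.count_append, List.take_append_drop]
  rw [hS]
  cases p with
  | cup =>
    simp only [pieceColourings, Multiset.mem_map] at hx
    obtain ⟨c, -, rfl⟩ := hx
    by_cases h : c = e <;>
      simp [h, linkTyped_cons_iff, linkTyped_nil_iff, src, tgt]; omega
  | cap =>
    simp only [pieceColourings] at hx
    split at hx
    · rename_i y z b hb
      split_ifs at hx with hyz
      · rw [Multiset.mem_singleton] at hx
        subst hx hyz
        rw [hb]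
        by_cases h : y = e <;>
          simp [h, linkTyped_cons_iff, linkTyped_nil_iff, src, tgt]; omega
      · simp at hx
    · simp at hx
  | cross s =>
    simp only [pieceColourings] at hx
    split at hx
    · rename_i y z b hb
      rw [Multiset.mem_singleton] at hx
      subst hx
      rw [hb]
      by_cases h : y = e <;> by_cases h' : z = e <;>
        simp [h, h', linkTyped_cons_iff, linkTyped_nil_iff, src, tgt]; omega
    · simp at hx

theorem colourings_typed {S : List Bool} {w : Word LinkPiece}
    {x : List Bool × (Bool → Word LinkPiece)} (hx : x ∈ colourings S w) (e : Bool) :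
    LinkTyped (S.count e) (x.2 e) (x.1.count e) := by
  induction w generalizing S x with
  | nil =>
    simp only [colourings, Multiset.mem_singleton] at hx
    subst hx
    exact .nil _
  | cons a w ih =>
    simp only [colourings, Multiset.mem_bind, Multiset.mem_map] at hx
    obtain ⟨y, hy, z, hz, rfl⟩ := hx
    exact (pieceColourings_typed hy e).append (ih hz)

theorem exists_drop_eq {S : List Bool} {i : ℕ} (h : i + 2 ≤ S.length) :
    ∃ x y b, S.drop i = x :: y :: b := by
  have h' : 2 ≤ (S.drop i).length := by rw [List.length_drop]; omega
  match hS : S.drop i with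
  | [] | [_] => simp [hS] at h'
  | x :: y :: b => exact ⟨x, y, b, rfl⟩

theorem pieceColourings_length {S : List Bool} {i : ℕ} {p : LinkPiece} (h : i + src p ≤ S.length)
    {x : List Bool × (Bool → Word LinkPiece)} (hx : x ∈ pieceColourings S i p) :
    x.1.length = S.length - src p + tgt p := by
  cases p with
  | cup =>
    simp only [pieceColourings, Multiset.mem_map] at hx
    obtain ⟨c, -, rfl⟩ := hx
    simp [src, tgt] at h ⊢
    omega
  | cap =>
    obtain ⟨y, z, b, hb⟩ := exists_drop_eq h
    have := congrArg List.length hb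
    simp only [pieceColourings, hb] at hx
    split_ifs at hx
    · rw [Multiset.mem_singleton] at hx
      subst hx
      simp [src, tgt] at this h ⊢
      omega
    · simp at hx
  | cross s =>
    obtain ⟨y, z, b, hb⟩ := exists_drop_eq h
    have := congrArg List.length hb
    simp only [pieceColourings, hb, Multiset.mem_singleton] at hx
    subst hx
    simp [src, tgt] at this h ⊢
    omega

theorem colourings_length {S : List Bool} {n : ℕ} {w : Word LinkPiece}
    (hw : LinkTyped S.length w n) {x : List Bool × (Bool → Word LinkPiece)}
    (hx : x ∈ colourings S w) : x.1.length = n := by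
  induction w generalizing S x with
  | nil =>
    simp only [colourings, Multiset.mem_singleton] at hx
    subst hx
    exact linkTyped_nil_iff.1 hw
  | cons a w ih =>
    obtain ⟨i, p⟩ := a
    rw [linkTyped_cons_iff] at hw
    simp only [colourings, Multiset.mem_bind, Multiset.mem_map] at hx
    obtain ⟨y, hy, z, hz, rfl⟩ := hx
    exact ih (x := z) (by rw [pieceColourings_length hw.1 hy]; exact hw.2) hz

theorem pieceColourings_shift (a S b : List Bool) {i : ℕ} {p : LinkPiece}
    (h : i + src p ≤ S.length) :
    pieceColourings (a ++ S ++ b) (a.length + i) p = (pieceColourings S i p).map fun x =>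
      (a ++ x.1 ++ b, fun e => (x.2 e).shift (a.count e)) := by
  have hi : i ≤ S.length := by omega
  have ht : (a ++ S ++ b).take (a.length + i) = a ++ S.take i := by
    rw [List.append_assoc, List.take_length_add_append, List.take_append_of_le_length hi]
  have hd : (a ++ S ++ b).drop (a.length + i) = S.drop i ++ b := by
    rw [List.append_assoc, List.drop_length_add_append, List.drop_append_of_le_length hi]
  cases p with
  | cup =>
    simp only [pieceColourings, Multiset.map_map, Function.comp_def, ht, hd]
    refine Multiset.map_congr rfl fun c _ => ?_
    refine Prod.ext (by simp) (funext fun e => ?_)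
    by_cases hc : c = e <;> simp [hc]
  | cap =>
    obtain ⟨y, z, b', hb⟩ := exists_drop_eq h
    simp only [pieceColourings, ht, hd, hb, List.cons_append]
    by_cases hyz : y = z
    · simp only [hyz, if_true, Multiset.map_singleton, Multiset.singleton_inj]
      refine Prod.ext (by simp) (funext fun e => ?_)
      by_cases hc : z = e <;> simp [hc]
    · simp [hyz]
  | cross s =>
    obtain ⟨y, z, b', hb⟩ := exists_drop_eq h
    simp only [pieceColourings, ht, hd, hb, List.cons_append, Multiset.map_singleton,
      Multiset.singleton_inj]
    refine Prod.ext (by simp) (funext fun e => ?_)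
    by_cases hc : y = e <;> by_cases hc' : z = e <;> simp [hc, hc']

/-- Strands on either side of a word keep their colours. -/
theorem colourings_shift (a S b : List Bool) {w : Word LinkPiece} (h : Word.Fits S.length w) :
    colourings (a ++ S ++ b) (w.shift a.length) = (colourings S w).map fun x =>
      (a ++ x.1 ++ b, fun e => (x.2 e).shift (a.count e)) := by
  induction w generalizing S with
  | nil => simp [colourings]
  | cons y w ih =>
    obtain ⟨i, p⟩ := y
    obtain ⟨h₁, h₂⟩ := h
    simp only [colourings, Word.shift_cons, pieceColourings_shift a S b h₁, Multiset.bind_map,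
      Multiset.map_bind, Multiset.map_map, Function.comp_def, Word.shift_append]
    refine Multiset.bind_congr fun x hx => ?_
    rw [ih x.1 (by rw [pieceColourings_length h₁ hx]; exact h₂)]
    simp only [Multiset.map_map, Function.comp_def]

/-- The colourings of two words correspond to each other in such a way that corresponding colourings
have the same colours at the top and isotopic sublinks of either colour. -/
def ColourEquiv (S : List Bool) (w w' : Word LinkPiece) : Prop :=
  Multiset.Rel (fun x y => x.1 = y.1 ∧
    ∀ e, Isotopic LinkMove (S.count e) (x.1.count e) (x.2 e) (y.2 e))
    (colourings S w) (colourings S w')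

theorem ColourEquiv.context {S : List Bool} {u w w' : Word LinkPiece} (v : Word LinkPiece)
    (h : ∀ x ∈ colourings S u, ColourEquiv x.1 w w') :
    ColourEquiv S (u ++ w ++ v) (u ++ w' ++ v) := by
  unfold ColourEquiv
  simp only [colourings_append]
  have h₁ : Multiset.Rel (fun x y : List Bool × (Bool → Word LinkPiece) => x.1 = y.1 ∧
      ∀ e, LinkTyped (S.count e) (x.2 e) (x.1.count e) ∧
        Isotopic LinkMove (S.count e) (x.1.count e) (x.2 e) (y.2 e))
      ((colourings S u).bind fun x =>
        (colourings x.1 w).map fun y => (y.1, fun e => x.2 e ++ y.2 e))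
      ((colourings S u).bind fun x =>
        (colourings x.1 w').map fun y => (y.1, fun e => x.2 e ++ y.2 e)) := by
    refine Multiset.rel_bind (r := fun x y => x = y ∧ x ∈ colourings S u) ?_
      (Multiset.rel_refl_of_refl_on fun x hx => ⟨rfl, hx⟩)
    rintro x _ ⟨rfl, hx⟩
    rw [Multiset.rel_map]
    refine (h x hx).mono fun y hy z _ hyz => ⟨hyz.1, fun e => ?_⟩
    have ht := colourings_typed hx e
    exact ⟨ht.append (colourings_typed hy e), (hyz.2 e).append_left ht⟩
  refine Multiset.rel_bind ?_ h₁
  rintro ⟨T, f⟩ ⟨T', g⟩ ⟨hT, hfg⟩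
  obtain rfl : T = T' := hT
  rw [Multiset.rel_map]
  refine Multiset.rel_refl_of_refl_on fun y hy => ⟨rfl, fun e => ?_⟩
  exact (hfg e).2.append_right (colourings_typed hy e)

/-- The colours of the strands below a local move have exactly one extension to a colouring of the
move, on both of its sides.  The deletion of strands makes it trivial or turns it into another local
move. -/
theorem LinkMove.colourings_eq {l r : Word LinkPiece} (h : LinkMove l r) :
    ∃ m n, LinkTyped m l n ∧ LinkTyped m r n ∧ (∀ p k, Word.Fits p (l.shift k) → k + m ≤ p) ∧
      ∀ S : List Bool, S.length = m → ∃ T f g, colourings S l = {(T, f)} ∧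
        colourings S r = {(T, g)} ∧ ∀ e, f e = g e ∨ LinkMove (f e) (g e) := by
  cases h with
  | zigzagRight | zigzagLeft =>
    refine ⟨1, 1, typedb_iff.1 rfl, typedb_iff.1 rfl,
      fun p k h => by simp [Word.Fits, src, tgt] at h; omega, fun S hS => ?_⟩
    obtain ⟨x, rfl⟩ := List.length_eq_one_iff.1 hS
    cases x <;> refine ⟨_, _, _, rfl, rfl, fun e => ?_⟩ <;> cases e <;>
      first | exact .inl rfl | exact .inr .zigzagRight | exact .inr .zigzagLeft
  | rIRight s | rILeft s =>
    refine ⟨1, 1, typedb_iff.1 rfl, typedb_iff.1 rfl,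
      fun p k h => by simp [Word.Fits, src, tgt] at h; omega, fun S hS => ?_⟩
    obtain ⟨x, rfl⟩ := List.length_eq_one_iff.1 hS
    cases x <;> refine ⟨_, _, _, rfl, rfl, fun e => ?_⟩ <;> cases e <;>
      first | exact .inl rfl | exact .inr (.rIRight s) | exact .inr (.rILeft s)
  | rotateLeft s | rotateRight s | rII s =>
    refine ⟨2, 2, typedb_iff.1 rfl, typedb_iff.1 rfl,
      fun p k h => by simp [Word.Fits, src, tgt] at h; omega, fun S hS => ?_⟩
    obtain ⟨x, y, rfl⟩ := List.length_eq_two.1 hS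
    -- Deleting one of the two strands of a rotated crossing leaves a zigzag or a vertical strand.
    cases x <;> cases y <;> refine ⟨_, _, _, rfl, rfl, fun e => ?_⟩ <;> cases e <;>
      first
      | exact .inl rfl
      | exact .inr .zigzagRight
      | exact .inr .zigzagLeft
      | exact .inr (.rotateLeft s)
      | exact .inr (.rotateRight s)
      | exact .inr (.rII s)
  | rIII s t u h =>
    refine ⟨3, 3, typedb_iff.1 rfl, typedb_iff.1 rfl,
      fun p k h => by simp [Word.Fits, src, tgt] at h; omega, fun S hS => ?_⟩
    obtain ⟨x, y, z, rfl⟩ := List.length_eq_three.1 hS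
    cases x <;> cases y <;> cases z <;> refine ⟨_, _, _, rfl, rfl, fun e => ?_⟩ <;> cases e <;>
      first | exact .inl rfl | exact .inr (.rIII s t u h)

theorem LinkMove.colourEquiv {l r : Word LinkPiece} (h : LinkMove l r) {S : List Bool} {k n : ℕ}
    (hS : LinkTyped S.length (l.shift k) n) : ColourEquiv S (l.shift k) (r.shift k) := by
  obtain ⟨m, n, hl, hr, hf, hc⟩ := h.colourings_eq
  have hk := hf _ _ hS.fits
  obtain ⟨a, S₀, b, rfl, rfl, rfl⟩ :
      ∃ a S₀ b : List Bool, S = a ++ S₀ ++ b ∧ a.length = k ∧ S₀.length = m := by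
    refine ⟨S.take k, (S.drop k).take m, (S.drop k).drop m, ?_, ?_, ?_⟩
    · rw [List.append_assoc, List.take_append_drop, List.take_append_drop]
    · rw [List.length_take]; omega
    · rw [List.length_take, List.length_drop]; omega
  obtain ⟨T, f, g, hlf, hrg, hfg⟩ := hc S₀ rfl
  unfold ColourEquiv
  rw [colourings_shift a S₀ b hl.fits, colourings_shift a S₀ b hr.fits, Multiset.rel_map, hlf, hrg]
  refine Multiset.rel_cons_left.2 ⟨(T, g), 0, ⟨rfl, fun e => ?_⟩, .zero, rfl⟩
  have htf : LinkTyped (S₀.count e) (f e) (T.count e) :=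
    colourings_typed (w := l) (x := (T, f)) (by simp [hlf]) e
  have htg : LinkTyped (S₀.count e) (g e) (T.count e) :=
    colourings_typed (w := r) (x := (T, g)) (by simp [hrg]) e
  simp only [List.count_append]
  refine Isotopic.shift ?_ _ _
  obtain h | h := hfg e
  · exact .of_eq h
  · exact .of_step htf htg (by simpa using Word.Step.move [] [] 0 h)

theorem colourEquiv_far {S : List Bool} {n : ℕ} (p q : LinkPiece) (i k : ℕ)
    (hS : LinkTyped S.length [(i, p), (i + tgt p + k, q)] n) :
    ColourEquiv S [(i, p), (i + tgt p + k, q)] [(i + src p + k, q), (i, p)] := by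
  simp only [linkTyped_cons_iff, linkTyped_nil_iff] at hS
  obtain ⟨a, A, b, B, c, rfl, rfl, hA, rfl, hB⟩ :
      ∃ a A b B c : List Bool, S = a ++ A ++ b ++ B ++ c ∧ a.length = i ∧ A.length = src p ∧
        b.length = k ∧ B.length = src q := by
    refine ⟨S.take i, (S.drop i).take (src p), ((S.drop i).drop (src p)).take k,
      (((S.drop i).drop (src p)).drop k).take (src q),
      (((S.drop i).drop (src p)).drop k).drop (src q), ?_, ?_, ?_, ?_, ?_⟩
    · simp only [List.append_assoc, List.take_append_drop]
    all_goals simp only [List.length_take, List.length_drop]; omega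
  have hpA : Word.Fits A.length [(0, p)] := ⟨by omega, trivial⟩
  have hqB : Word.Fits B.length [(0, q)] := ⟨by omega, trivial⟩
  have lp : ∀ R : List Bool, colourings (a ++ A ++ R) [(a.length, p)] = (colourings A [(0, p)]).map
      fun x => (a ++ x.1 ++ R, fun e => (x.2 e).shift (a.count e)) := fun R =>
    colourings_shift a A R hpA
  have lq : ∀ R : List Bool, colourings (R ++ B ++ c) [(R.length, q)] = (colourings B [(0, q)]).map
      fun x => (R ++ x.1 ++ c, fun e => (x.2 e).shift (R.count e)) := fun R =>
    colourings_shift R B c hqB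
  have e₁ : colourings (a ++ A ++ b ++ B ++ c) ([(a.length, p)] ++ [(a.length + tgt p + b.length, q)])
      = (colourings A [(0, p)]).bind fun x => (colourings B [(0, q)]).map fun y =>
        (a ++ x.1 ++ b ++ y.1 ++ c, fun e => (x.2 e).shift (a.count e) ++
          (y.2 e).shift ((a ++ x.1 ++ b).count e)) := by
    rw [colourings_append, show a ++ A ++ b ++ B ++ c = a ++ A ++ (b ++ B ++ c) by simp, lp,
      Multiset.bind_map]
    refine Multiset.bind_congr fun x hx => ?_
    have hx' : x.1.length = tgt p := colourings_length
      (linkTyped_cons_iff.2 ⟨by omega, linkTyped_nil_iff.2 (by omega)⟩) hx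
    have := lq (a ++ x.1 ++ b)
    rw [List.length_append, List.length_append, hx'] at this
    simp only [show a ++ x.1 ++ (b ++ B ++ c) = a ++ x.1 ++ b ++ B ++ c by simp, this,
      Multiset.map_map, Function.comp_def]
  have e₂ : colourings (a ++ A ++ b ++ B ++ c) ([(a.length + src p + b.length, q)] ++ [(a.length, p)])
      = (colourings B [(0, q)]).bind fun y => (colourings A [(0, p)]).map fun x =>
        (a ++ x.1 ++ b ++ y.1 ++ c, fun e => (y.2 e).shift ((a ++ A ++ b).count e) ++
          (x.2 e).shift (a.count e)) := by
    have := lq (a ++ A ++ b)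
    rw [List.length_append, List.length_append, hA] at this
    rw [colourings_append, this, Multiset.bind_map]
    refine Multiset.bind_congr fun y _ => ?_
    simp only [show a ++ A ++ b ++ y.1 ++ c = a ++ A ++ (b ++ y.1 ++ c) by simp, lp,
      Multiset.map_map, Function.comp_def]
    simp
  unfold ColourEquiv
  simp only [List.singleton_append] at e₁ e₂
  rw [e₁, e₂, Multiset.bind_map_comm (colourings B _)]
  refine Multiset.rel_bind (r := fun x y => x = y ∧ x ∈ colourings A [(0, p)]) ?_
    (Multiset.rel_refl_of_refl_on fun x hx => ⟨rfl, hx⟩)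
  rintro x _ ⟨rfl, hx⟩
  rw [Multiset.rel_map]
  refine Multiset.rel_refl_of_refl_on fun y hy => ⟨rfl, fun e => ?_⟩
  have hx' := colourings_typed hx e
  have hy' := colourings_typed hy e
  have hfar : FarEq ((x.2 e).shift (a.count e) ++ (y.2 e).shift ((a ++ x.1 ++ b).count e))
      ((y.2 e).shift ((a ++ A ++ b).count e) ++ (x.2 e).shift (a.count e)) := by
    have h := farEq_interchange hx' (b.count e) (y.2 e)
    have : FarEq _ _ := eqvGen_map (Word.shift (a.count e)) (fun _ _ h => h.shift (a.count e)) h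
    simpa [Word.shift_shift, Nat.add_assoc] using this
  refine hfar.isotopic ?_
  have h₁ := hx'.shift (a.count e) ((b ++ B ++ c).count e)
  have h₂ := hy'.shift ((a ++ x.1 ++ b).count e) (c.count e)
  refine LinkTyped.append (n := a.count e + x.1.count e + (b ++ B ++ c).count e) ?_ ?_
  · simpa [Nat.add_assoc] using h₁
  · simpa [Nat.add_assoc] using h₂

theorem colourEquiv_step {w w' : Word LinkPiece} (h : Word.Step LinkMove w w')
    (hw : LinkTyped 0 w 0) : ColourEquiv [] w w' := by
  cases h with
  | move u v k h =>
    obtain ⟨q, hul, -⟩ := linkTyped_append_iff.1 hw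
    obtain ⟨p, hu, hl⟩ := linkTyped_append_iff.1 hul
    refine ColourEquiv.context v fun x hx => h.colourEquiv (n := q) ?_
    rwa [colourings_length (S := []) hu hx]
  | far u v p q i k =>
    obtain ⟨q', hul, -⟩ := linkTyped_append_iff.1 hw
    obtain ⟨p', hu, hl⟩ := linkTyped_append_iff.1 hul
    refine ColourEquiv.context v fun x hx => colourEquiv_far p q i k (n := q') ?_
    rwa [colourings_length (S := []) hu hx]

theorem colourings_closed {w : Word LinkPiece} (hw : LinkTyped 0 w 0)
    {x : List Bool × (Bool → Word LinkPiece)} (hx : x ∈ colourings [] w) :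
    x.1 = [] ∧ ∀ e, LinkTyped 0 (x.2 e) 0 := by
  have h : x.1 = [] := List.length_eq_zero_iff.1 (colourings_length (S := []) hw hx)
  exact ⟨h, fun e => by simpa [h] using colourings_typed hx e⟩

/-- Isotopic link diagrams have the same number of colourings, and every colouring of one of them is
carried to a colouring of the other with isotopic sublinks. -/
theorem Isotopic.colourings {w w' : Word LinkPiece} (h : Isotopic LinkMove 0 0 w w') :
    (colourings [] w).card = (colourings [] w').card ∧
    (∀ x ∈ colourings [] w, ∃ y ∈ colourings [] w',
      ∀ e, Isotopic LinkMove 0 0 (x.2 e) (y.2 e)) ∧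
    (∀ y ∈ colourings [] w', ∃ x ∈ colourings [] w,
      ∀ e, Isotopic LinkMove 0 0 (x.2 e) (y.2 e)) := by
  induction h with
  | rel w w' h =>
    have hc := colourEquiv_step h.2.2 h.1
    refine ⟨Multiset.card_eq_card_of_rel hc, fun x hx => ?_, fun y hy => ?_⟩
    · obtain ⟨y, hy, -, hxy⟩ := Multiset.exists_mem_of_rel_of_mem hc hx
      exact ⟨y, hy, fun e => by simpa [(colourings_closed h.1 hx).1] using hxy e⟩
    · obtain ⟨x, hx, -, hxy⟩ := Multiset.exists_mem_of_rel_of_mem (Multiset.rel_flip.2 hc) hy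
      exact ⟨x, hx, fun e => by simpa [(colourings_closed h.1 hx).1] using hxy e⟩
  | refl w => exact ⟨rfl, fun x hx => ⟨x, hx, fun e => .refl _⟩, fun x hx => ⟨x, hx, fun e => .refl _⟩⟩
  | symm w w' _ ih =>
    obtain ⟨h₁, h₂, h₃⟩ := ih
    refine ⟨h₁.symm, fun y hy => ?_, fun x hx => ?_⟩
    · obtain ⟨x, hx, hxy⟩ := h₃ y hy
      exact ⟨x, hx, fun e => (hxy e).symm⟩
    · obtain ⟨y, hy, hxy⟩ := h₂ x hx
      exact ⟨y, hy, fun e => (hxy e).symm⟩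
  | trans u v w _ _ ih₁ ih₂ =>
    obtain ⟨h₁, h₂, h₃⟩ := ih₁
    obtain ⟨k₁, k₂, k₃⟩ := ih₂
    refine ⟨h₁.trans k₁, fun x hx => ?_, fun z hz => ?_⟩
    · obtain ⟨y, hy, hxy⟩ := h₂ x hx
      obtain ⟨z, hz, hyz⟩ := k₂ y hy
      exact ⟨z, hz, fun e => (hxy e).trans (hyz e)⟩
    · obtain ⟨y, hy, hyz⟩ := k₃ z hz
      obtain ⟨x, hx, hxy⟩ := h₃ y hy
      exact ⟨x, hx, fun e => (hxy e).trans (hyz e)⟩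

theorem pieceColourings_constant (c : Bool) {m i : ℕ} {p : LinkPiece} (h : i + src p ≤ m) :
    (List.replicate (m - src p + tgt p) c, fun e => if c = e then [(i, p)] else []) ∈
      pieceColourings (List.replicate m c) i p := by
  obtain ⟨k, rfl⟩ := Nat.exists_eq_add_of_le h
  have ht : (List.replicate (i + src p + k) c).take i = List.replicate i c := by simp; omega
  have hd : (List.replicate (i + src p + k) c).drop i = List.replicate (src p + k) c := by
    simp; omega
  have hadd (a b : ℕ) : List.replicate a c ++ List.replicate b c = List.replicate (a + b) c :=
    List.replicate_append_replicate
  cases p with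
  | cup =>
    simp only [pieceColourings, Multiset.mem_map, ht, hd]
    refine ⟨c, by cases c <;> simp, Prod.ext ?_ (funext fun e => ?_)⟩
    · simp only [src, tgt, ← List.replicate_succ, hadd]
      congr 1
      omega
    · by_cases hc : c = e <;> simp [hc]
  | cap =>
    have h₂ : List.replicate (src LinkPiece.cap + k) c = c :: c :: List.replicate k c := by
      rw [show src LinkPiece.cap + k = k + 1 + 1 from Nat.add_comm 2 k]; rfl
    simp only [pieceColourings, ht, hd, h₂, if_true, Multiset.mem_singleton]
    refine Prod.ext ?_ (funext fun e => ?_)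
    · simp only [src, tgt, hadd]
      congr 1
      omega
    · by_cases hc : c = e <;> simp [hc]
  | cross s =>
    have h₂ : List.replicate (src (LinkPiece.cross s) + k) c = c :: c :: List.replicate k c := by
      rw [show src (LinkPiece.cross s) + k = k + 1 + 1 from Nat.add_comm 2 k]; rfl
    simp only [pieceColourings, ht, hd, h₂, Multiset.mem_singleton]
    refine Prod.ext ?_ (funext fun e => ?_)
    · simp only [src, tgt, ← List.replicate_succ, hadd]
      congr 1
      omega
    · by_cases hc : c = e <;> simp [hc]

/-- All strands may be given the same colour. -/
theorem colourings_constant (c : Bool) {m n : ℕ} {w : Word LinkPiece} (h : LinkTyped m w n) :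
    (List.replicate n c, fun e => if c = e then w else []) ∈
      colourings (List.replicate m c) w := by
  induction w generalizing m with
  | nil =>
    obtain rfl := linkTyped_nil_iff.1 h
    simp [colourings]
  | cons x w ih =>
    obtain ⟨i, p⟩ := x
    rw [linkTyped_cons_iff] at h
    simp only [colourings, Multiset.mem_bind, Multiset.mem_map]
    refine ⟨_, pieceColourings_constant c h.1, _, ih h.2, Prod.ext rfl (funext fun e => ?_)⟩
    by_cases hc : c = e <;> simp [hc]

theorem pieceColourings_no_false {m i : ℕ} {p : LinkPiece} (h : i + src p ≤ m)
    {x : List Bool × (Bool → Word LinkPiece)}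
    (hx : x ∈ pieceColourings (List.replicate m true) i p) (hf : x.2 false = []) :
    x.1 = List.replicate (m - src p + tgt p) true ∧ x.2 true = [(i, p)] := by
  have key : x = (List.replicate (m - src p + tgt p) true,
      fun e => if true = e then [(i, p)] else []) := by
    have hc := pieceColourings_constant true h
    cases p with
    | cup =>
      simp only [pieceColourings, Multiset.mem_map] at hx hc
      obtain ⟨c, -, rfl⟩ := hx
      obtain ⟨c', -, hc'⟩ := hc
      have hc₂ := congrFun (congrArg Prod.snd hc') false
      cases c
      · simp at hf
      · cases c'
        · simp at hc₂
        · exact hc'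
    | cap =>
      obtain ⟨y, z, b, hb⟩ := exists_drop_eq (S := List.replicate m true)
        (by simpa [src] using h)
      simp only [pieceColourings, hb] at hx hc
      split_ifs at hx hc
      · rw [Multiset.mem_singleton] at hx hc
        exact hx.trans hc.symm
      · simp at hx
    | cross s =>
      obtain ⟨y, z, b, hb⟩ := exists_drop_eq (S := List.replicate m true)
        (by simpa [src] using h)
      simp only [pieceColourings, hb, Multiset.mem_singleton] at hx hc
      exact hx.trans hc.symm
  subst key
  simp

/-- If no strand has the second colour, then all strands have the first one. -/
theorem colourings_no_false {m n : ℕ} {w : Word LinkPiece} (h : LinkTyped m w n)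
    {x : List Bool × (Bool → Word LinkPiece)}
    (hx : x ∈ colourings (List.replicate m true) w) (hf : x.2 false = []) : x.2 true = w := by
  induction w generalizing m x with
  | nil =>
    simp only [colourings, Multiset.mem_singleton] at hx
    rw [hx]
  | cons a w ih =>
    obtain ⟨i, p⟩ := a
    rw [linkTyped_cons_iff] at h
    simp only [colourings, Multiset.mem_bind, Multiset.mem_map] at hx
    obtain ⟨y, hy, z, hz, rfl⟩ := hx
    obtain ⟨hyf, hzf⟩ := List.append_eq_nil_iff.1 hf
    obtain ⟨hy₁, hy₂⟩ := pieceColourings_no_false h.1 hy hyf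
    rw [hy₁] at hz
    simp only [hy₂, ih h.2 hz hzf]
    rfl

theorem card_colourings_pos {w : Word LinkPiece} (hw : LinkTyped 0 w 0) :
    0 < (colourings [] w).card :=
  Multiset.card_pos_iff_exists_mem.2 ⟨_, colourings_constant true hw⟩

/-- A nonempty diagram has the two constant colourings. -/
theorem eq_nil_of_card_colourings {w : Word LinkPiece} (hw : LinkTyped 0 w 0)
    (h : (colourings [] w).card = 1) : w = [] := by
  obtain ⟨x, hx⟩ := Multiset.card_eq_one.1 h
  have h₁ := colourings_constant true hw
  have h₂ := colourings_constant false hw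
  simp only [List.replicate_zero, hx, Multiset.mem_singleton] at h₁ h₂
  simpa using congrFun (congrArg Prod.snd (h₁.trans h₂.symm)) true

theorem colourings_circle : colourings [] (circles 1) =
    {([], fun e => if true = e then circles 1 else []),
      ([], fun e => if false = e then circles 1 else [])} := by
  have h : ∀ c : Bool, (([] : List Bool), fun e : Bool =>
      ((if c = e then [(0, LinkPiece.cup)] else []) ++
        ((if c = e then [(0, LinkPiece.cap)] else []) ++ []) : Word LinkPiece)) =
      ([], fun e => if c = e then circles 1 else []) := fun c =>
    Prod.ext rfl (funext fun e => by by_cases hc : c = e <;> simp [hc, circles])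
  rw [← h true, ← h false]
  rfl

theorem card_colourings_circles {w : Word LinkPiece} (hw : LinkTyped 0 w 0) (n : ℕ) :
    (colourings [] (w ++ circles n)).card = (colourings [] w).card * 2 ^ n := by
  induction n with
  | zero => simp [circles]
  | succ n ih =>
    have key : ∀ x ∈ colourings [] (w ++ circles n), (colourings x.1 (circles 1)).card = 2 :=
      fun x hx => by
        rw [(colourings_closed (hw.append (linkTyped_circles n)) hx).1, colourings_circle]
        rfl
    rw [circles_add, ← List.append_assoc, colourings_append, Multiset.card_bind,
      Multiset.map_congr rfl (g := fun _ => 2) fun x hx => by simpa using key x hx]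
    simp [ih, pow_succ, mul_assoc]

/-- A colouring of a diagram with separate circles gives each circle one of the two colours. -/
theorem mem_colourings_circles {w : Word LinkPiece} (hw : LinkTyped 0 w 0) (n : ℕ)
    {x : List Bool × (Bool → Word LinkPiece)} (hx : x ∈ colourings [] (w ++ circles n)) :
    ∃ y ∈ colourings [] w, ∃ j k, j + k = n ∧ x.2 true = y.2 true ++ circles j ∧
      x.2 false = y.2 false ++ circles k := by
  induction n generalizing x with
  | zero => exact ⟨x, by simpa [circles] using hx, 0, 0, rfl, by simp [circles], by simp [circles]⟩
  | succ n ih =>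
    rw [circles_add, ← List.append_assoc, colourings_append] at hx
    simp only [Multiset.mem_bind, Multiset.mem_map] at hx
    obtain ⟨z, hz, z', hz', rfl⟩ := hx
    rw [(colourings_closed (hw.append (linkTyped_circles n)) hz).1, colourings_circle,
      Multiset.insert_eq_cons, Multiset.mem_cons, Multiset.mem_singleton] at hz'
    obtain ⟨y, hy, j, k, hjk, h₁, h₂⟩ := ih hz
    obtain rfl | rfl := hz'
    · exact ⟨y, hy, j + 1, k, by omega, by simp [h₁, circles_add], by simp [h₂]⟩
    · exact ⟨y, hy, j, k + 1, by omega, by simp [h₁], by simp [h₂, circles_add]⟩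

/-! ### Removal of unlinked unknotted components -/

/-- The diagram has no unlinked unknotted component. -/
def NoCircle (w : Word LinkPiece) : Prop :=
  ∀ v, LinkTyped 0 v 0 → ¬ Isotopic LinkMove 0 0 w (v ++ circles 1)

/-- If `u` has no separate circle, then its sublink in `v` is found by deleting the components of `v`
that come from the `n` circles; all of the `m` circles are among the deleted components. -/
theorem NoCircle.exists_colouring {u v : Word LinkPiece} {n m : ℕ} (hu : LinkTyped 0 u 0)
    (hv : LinkTyped 0 v 0) (hr : NoCircle u)
    (h : Isotopic LinkMove 0 0 (u ++ circles n) (v ++ circles m)) :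
    ∃ y ∈ colourings [] v, Isotopic LinkMove 0 0 u (y.2 true) ∧
      2 ^ n = (colourings [] (y.2 false)).card * 2 ^ m := by
  have h₀ : ([], fun e => (if true = e then u else []) ++ (if false = e then circles n else [])) ∈
      colourings [] (u ++ circles n) := by
    rw [colourings_append]
    simp only [Multiset.mem_bind, Multiset.mem_map]
    exact ⟨_, colourings_constant true hu, _,
      colourings_constant false (linkTyped_circles n), rfl⟩
  obtain ⟨x, hx, hxe⟩ := h.colourings.2.1 _ h₀
  obtain ⟨y, hy, j, k, hjk, h₁, h₂⟩ := mem_colourings_circles hv m hx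
  have ht := (colourings_closed hv hy).2
  have e₁ : Isotopic LinkMove 0 0 u (y.2 true ++ circles j) := by
    simpa [h₁] using hxe true
  have e₂ : Isotopic LinkMove 0 0 (circles n) (y.2 false ++ circles k) := by
    simpa [h₂] using hxe false
  obtain rfl : j = 0 := by
    by_contra hj
    obtain ⟨i, rfl⟩ := Nat.exists_eq_succ_of_ne_zero hj
    refine hr (y.2 true ++ circles i) ((ht true).append (linkTyped_circles i)) ?_
    rwa [List.append_assoc, ← circles_add]
  obtain rfl : k = m := by omega
  refine ⟨y, hy, by simpa [circles] using e₁, ?_⟩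
  have hcard := e₂.colourings.1
  rw [card_colourings_circles (ht false)] at hcard
  rw [← hcard]
  simpa [colourings] using (card_colourings_circles (.nil 0) n).symm

/-- Uniqueness of the removal of separate circles.  Deleting the components that come from the circles
of one side shows that the number of circles on the other side is not larger.  Hence the numbers agree,
and then no component of `v` is deleted. -/
theorem NoCircle.isotopic {u v : Word LinkPiece} {n m : ℕ} (hu : LinkTyped 0 u 0)
    (hv : LinkTyped 0 v 0) (hru : NoCircle u) (hrv : NoCircle v)
    (h : Isotopic LinkMove 0 0 (u ++ circles n) (v ++ circles m)) : Isotopic LinkMove 0 0 u v := by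
  obtain ⟨y, hy, huy, hn⟩ := hru.exists_colouring hu hv h
  obtain ⟨z, hz, -, hm⟩ := hrv.exists_colouring hv hu h.symm
  have hyp := card_colourings_pos ((colourings_closed hv hy).2 false)
  have hzp := card_colourings_pos ((colourings_closed hu hz).2 false)
  have hnm : 2 ^ n = 2 ^ m := le_antisymm (hm ▸ Nat.le_mul_of_pos_left _ hzp)
    (hn ▸ Nat.le_mul_of_pos_left _ hyp)
  rw [hnm] at hn
  have hcard : (colourings [] (y.2 false)).card = 1 :=
    (Nat.eq_of_mul_eq_mul_right (by positivity) (hn.symm.trans (one_mul _).symm))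
  have hnil := eq_nil_of_card_colourings ((colourings_closed hv hy).2 false) hcard
  rwa [colourings_no_false hv hy hnil] at huy

/-- Separate circles can be removed only finitely often, as every circle doubles the number of
colourings. -/
theorem exists_noCircle {w : Word LinkPiece} (hw : LinkTyped 0 w 0) :
    ∃ v n, LinkTyped 0 v 0 ∧ NoCircle v ∧ Isotopic LinkMove 0 0 w (v ++ circles n) := by
  induction hc : (colourings [] w).card using Nat.strong_induction_on generalizing w with
  | _ c ih =>
    by_cases hr : NoCircle w
    · exact ⟨w, 0, hw, hr, by simpa [circles] using Isotopic.refl w⟩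
    · simp only [NoCircle, not_forall, not_not] at hr
      obtain ⟨v, hv, h⟩ := hr
      have h₁ := h.colourings.1
      rw [card_colourings_circles hv, hc] at h₁
      have hpos := card_colourings_pos hv
      obtain ⟨v', n, hv', hr', h'⟩ := ih _ (by omega) hv rfl
      refine ⟨v', n + 1, hv', hr', ?_⟩
      rw [circles_add, ← List.append_assoc]
      exact h.trans (h'.append_right (linkTyped_circles 1))

theorem LinkDiagram.toLink_eq_iff {M N : LinkDiagram} :
    M.toLink = N.toLink ↔ Isotopic LinkMove 0 0 M.1 N.1 := by
  constructor
  · intro h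
    exact eqvGen_map Subtype.val (fun M N h => ⟨M.2, N.2, h⟩) (Quot.eqvGen_exact h)
  · obtain ⟨w, hw⟩ := M
    obtain ⟨w', hw'⟩ := N
    intro h
    change Isotopic LinkMove 0 0 w w' at h
    induction h with
    | rel w w' h => exact Quot.sound h.2.2
    | refl w => rfl
    | symm w w' _ ih => exact (ih hw' hw).symm
    | trans u v w h _ ih₁ ih₂ =>
      have hv := (Isotopic.typed_iff h).1 hw
      exact (ih₁ hw hv).trans (ih₂ hv hw')

theorem LinkDiagram.isReduced_iff {M : LinkDiagram} : M.toLink.IsReduced ↔ NoCircle M.1 := by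
  constructor
  · intro h v hv hM
    exact h ⟨v, hv⟩ (LinkDiagram.toLink_eq_iff.2 hM)
  · intro h N hN
    exact h N.1 N.2 (LinkDiagram.toLink_eq_iff.1 hN)

theorem Link.exists_isReductionOf (M : LinkDiagram) : ∃ K : Link, K.IsReductionOf M.toLink := by
  obtain ⟨v, n, hv, hr, h⟩ := exists_noCircle M.2
  obtain ⟨N, rfl⟩ : ∃ N : LinkDiagram, N.1 = v := ⟨⟨v, hv⟩, rfl⟩
  refine ⟨N.toLink, LinkDiagram.isReduced_iff.2 hr, N, n, rfl, ?_⟩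
  rw [LinkDiagram.toLink_eq_iff, LinkDiagram.addCircle_iterate]
  exact h

theorem Link.IsReductionOf.unique {K K' : Link} {M M' : LinkDiagram}
    (hK : K.IsReductionOf M.toLink) (hK' : K'.IsReductionOf M'.toLink)
    (h : Isotopic CircleMove 0 0 M.1 M'.1) : K = K' := by
  obtain ⟨hr, N, n, rfl, hN⟩ := hK
  obtain ⟨hr', N', n', rfl, hN'⟩ := hK'
  obtain ⟨a, b, hab⟩ := h.exists_circles
  rw [LinkDiagram.toLink_eq_iff, LinkDiagram.addCircle_iterate] at hN hN'
  have e₁ := hN.append_right (linkTyped_circles a)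
  have e₂ := hN'.append_right (linkTyped_circles b)
  rw [List.append_assoc, ← circles_add] at e₁ e₂
  exact LinkDiagram.toLink_eq_iff.2 (NoCircle.isotopic N.2 N'.2
    (LinkDiagram.isReduced_iff.1 hr) (LinkDiagram.isReduced_iff.1 hr')
    (e₁.symm.trans (hab.trans e₂)))

end FramedGraph

theorem mainTheorem1 (D D' : FramedGraph.GraphDiagram)
    (h : Relation.EqvGen FramedGraph.GraphDiagram.Move D D') :
    ∃ K : FramedGraph.Link, D.L = {K} ∧ D'.L = {K} := by
  have hDD' : FramedGraph.Isotopic FramedGraph.CircleMove 0 0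
      D.threeLineGraph.1 D'.threeLineGraph.1 := by
    induction h with
    | rel D D' h => exact FramedGraph.isotopic_threeLineWord h D.2
    | refl D => exact .refl _
    | symm D D' _ ih => exact FramedGraph.Isotopic.symm ih
    | trans D D' D'' _ _ ih₁ ih₂ => exact FramedGraph.Isotopic.trans ih₁ ih₂
  obtain ⟨K, hK⟩ := FramedGraph.Link.exists_isReductionOf D.threeLineGraph
  obtain ⟨K', hK'⟩ := FramedGraph.Link.exists_isReductionOf D'.threeLineGraph
  obtain rfl : K = K' := hK.unique hK' hDD'
  refine ⟨K, Set.eq_singleton_iff_unique_mem.2 ⟨hK, fun J hJ => ?_⟩,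
    Set.eq_singleton_iff_unique_mem.2 ⟨hK', fun J hJ => ?_⟩⟩
  · exact hJ.unique hK (.refl _)
  · exact hJ.unique hK' (.refl _)
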